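/- Let $\Omega$ be the category of (non-empty, finite, rooted) trees: its morphisms $S\to T$ are the morphisms $\Omega(S)\to\Omega(T)$ of symmetric coloured operads, where $\Omega(T)$ is the operad freely generated by the vertices of $T$, with the edges of $T$ as colours. Let $|T|$ be the number of vertices of $T$. A planar structure on $T$ is a linear order on the set of inputs of each vertex; the planar structures form a presheaf $P$ on $\Omega$, where for $f\colon S\to T$ and $p\in P(T)$ the inputs of a vertex of $S$ are ordered as their images, which are leaves of a subtree of $T$, are ordered from left to right by $p$. A planar structure $p$ labels the vertices of $T$ by $0,\dots,|T|-1$: the root vertex gets the label $0$, and after a vertex one labels all vertices of its first (leftmost) branch, then all those of its second branch, and so on, recursively. For $p,p'\in P(T)$ let $\mathrm{sgn}(p',p)\in\{\pm1\}$ be the sign of the permutation of the labels that takes the $p'$-label of each vertex to its $p$-label. The elementary faces $\partial_f\colon\partial_fT\to T$ are: the inner faces $\partial_e$, contracting an inner edge $e$; the top faces $\partial_w$, chopping off a vertex $w$ all of whose inputs are leaves, together with its inputs; and the bottom faces $\partial_{v,e}$, for the root vertex $v$ and an input $e$ of $v$ all of whose other inputs are leaves, chopping off $v$ with the root and all inputs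 of $v$ except $e$. Put $\mathrm{sgn}_p(\partial_e)=(-1)^k$ if $e$ is an inner edge and the vertex above $e$ has the label $k$, $\mathrm{sgn}_p(\partial_w)=(-1)^{k+1}$ if $w$ is a top vertex with the label $k$, and $\mathrm{sgn}_p(\partial_{v,e})=1$. (So for a corolla the inclusion of the root has the sign $-1$ and the inclusion of a leaf has the sign $+1$.) Let $X$ be a dendroidal set, i.e. a presheaf of sets on $\Omega$. For $n\ge 0$ let $Ch^{un}(X)_n$ be the quotient of the free abelian group on all triples $(T,p,x)$ with $T$ a tree, $|T|=n$, $p\in P(T)$ and $x\in X_T$, by the subgroup generated by all elements $$(T,p,x)-\mathrm{sgn}(p',\tau^*p)\,(T',p',\tau^*x)$$ for isomorphisms $\tau\colon T'\to T$, $p\in P(T)$, $p'\in P(T')$, $x\in X_T$. Write $[T,p,x]$ for the class of $(T,p,x)$. Let $D(X)_n\subseteq Ch^{un}(X)_n$ be the subgroup generated by the classes $[T,p,x]$ with $x$ degenerate, i.e. in the image of $\sigma^*$ for an elementary degeneracy map $\sigma$ with source $T$ (up to isomorphism, a map $\sigma_eS\to S$, where $\sigma_eS$ arises from $S$ by adding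 a copy $e'$ of an edge $e$ and a unary vertex between $e'$ and $e$). **Proposition.** There are unique homomorphisms $d\colon Ch^{un}(X)_{n+1}\to Ch^{un}(X)_{n}$, $n\ge0$, with $$d[T,p,x]=\sum_{\partial_f\colon\partial_fT\to T}\mathrm{sgn}_p(\partial_f)\,[\partial_fT,\ \partial_f^*p,\ \partial_f^*x]$$ for all $(T,p,x)$ with $|T|=n+1$, where the sum is over the set of elementary face maps of $T$. They satisfy $d\circ d=0$, so that $(Ch^{un}(X),d)$ is a chain complex, and $d(D(X)_{n+1})\subseteq D(X)_n$ for all $n\ge 0$, so that the degenerate dendrices generate a subcomplex. -/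

import Mathlib

universe u

namespace Dendroidal

open CategoryTheory

/-! ### Symmetric coloured operads -/

/-- A symmetric coloured operad in sets. Operations are indexed by a finite set `I` of inputs,
a colouring `c : I → Col` of the inputs and an output colour `c₀`; `reindex` is the action of
bijections of the index sets (in particular, of the symmetric groups), `one` are the identity
operations and `comp` is the full operadic composition. -/
structure ColouredOperad where
  Col : Type
  Op : (I : Type) → [Finite I] → (I → Col) → Col → Type
  one : (c : Col) → Op Unit (fun _ => c) c
  comp : {I : Type} → [Finite I] → {J : I → Type} → [∀ i, Finite (J i)] →
    {c : I → Col} → {c₀ : Col} → {d : (i : I) → J i → Col} →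
    Op I c c₀ → ((i : I) → Op (J i) (d i) (c i)) → Op (Σ i, J i) (fun k => d k.1 k.2) c₀
  reindex : {I J : Type} → [Finite I] → [Finite J] → (σ : I ≃ J) →
    {c : J → Col} → {c₀ : Col} → Op J c c₀ → Op I (fun i => c (σ i)) c₀
  reindex_refl : ∀ {I : Type} [Finite I] {c : I → Col} {c₀ : Col} (x : Op I c c₀),
    reindex (Equiv.refl I) x = x
  reindex_trans : ∀ {I J K : Type} [Finite I] [Finite J] [Finite K] (σ : I ≃ J) (τ : J ≃ K)
    {c : K → Col} {c₀ : Col} (x : Op K c c₀),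
    reindex (σ.trans τ) x = reindex σ (reindex τ x)
  comp_reindex_left : ∀ {I I' : Type} [Finite I] [Finite I'] (σ : I' ≃ I) {J : I → Type}
    [∀ i, Finite (J i)] {c : I → Col} {c₀ : Col} {d : (i : I) → J i → Col}
    (x : Op I c c₀) (y : (i : I) → Op (J i) (d i) (c i)),
    comp (reindex σ x) (fun i => y (σ i)) =
      reindex (Equiv.sigmaCongrLeft (β := J) σ) (comp x y)
  comp_reindex_right : ∀ {I : Type} [Finite I] {J J' : I → Type} [∀ i, Finite (J i)]
    [∀ i, Finite (J' i)] (τ : ∀ i, J' i ≃ J i) {c : I → Col} {c₀ : Col}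
    {d : (i : I) → J i → Col} (x : Op I c c₀) (y : (i : I) → Op (J i) (d i) (c i)),
    comp x (fun i => reindex (τ i) (y i)) = reindex (Equiv.sigmaCongrRight τ) (comp x y)
  one_comp : ∀ {J : Type} [Finite J] {c₀ : Col} {d : J → Col} (y : Op J d c₀),
    comp (J := fun _ => J) (d := fun _ => d) (one c₀) (fun _ => y) =
      reindex (⟨fun k => k.2, fun j => ⟨(), j⟩, fun _ => rfl, fun _ => rfl⟩ :
        (Σ _ : Unit, J) ≃ J) y
  comp_one : ∀ {I : Type} [Finite I] {c : I → Col} {c₀ : Col} (x : Op I c c₀),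
    comp x (fun i => one (c i)) = reindex (Equiv.sigmaPUnit I) x
  assoc : ∀ {I : Type} [Finite I] {J : I → Type} [∀ i, Finite (J i)]
    {K : (i : I) → J i → Type} [∀ i j, Finite (K i j)] {c : I → Col} {c₀ : Col}
    {d : (i : I) → J i → Col} {b : (i : I) → (j : J i) → K i j → Col}
    (x : Op I c c₀) (y : (i : I) → Op (J i) (d i) (c i))
    (z : (i : I) → (j : J i) → Op (K i j) (b i j) (d i j)),
    comp (comp x y) (fun k => z k.1 k.2) =
      reindex (Equiv.sigmaAssoc K) (comp x (fun i => comp (y i) (z i)))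

/-- A morphism of symmetric coloured operads. -/
structure ColouredOperad.Hom (P Q : ColouredOperad) where
  col : P.Col → Q.Col
  op : {I : Type} → [Finite I] → {c : I → P.Col} → {c₀ : P.Col} →
    P.Op I c c₀ → Q.Op I (fun i => col (c i)) (col c₀)
  op_one : ∀ c, op (P.one c) = Q.one (col c)
  op_comp : ∀ {I : Type} [Finite I] {J : I → Type} [∀ i, Finite (J i)]
    {c : I → P.Col} {c₀ : P.Col} {d : (i : I) → J i → P.Col}
    (x : P.Op I c c₀) (y : (i : I) → P.Op (J i) (d i) (c i)),
    op (P.comp x y) = Q.comp (op x) (fun i => op (y i))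
  op_reindex : ∀ {I J : Type} [Finite I] [Finite J] (σ : I ≃ J) {c : J → P.Col} {c₀ : P.Col}
    (x : P.Op J c c₀), op (P.reindex σ x) = Q.reindex σ (op x)

/-- The identity morphism. -/
def ColouredOperad.Hom.id (P : ColouredOperad) : ColouredOperad.Hom P P where
  col c := c
  op x := x
  op_one _ := rfl
  op_comp _ _ := rfl
  op_reindex := by intros; rfl

/-- The composition of morphisms. -/
def ColouredOperad.Hom.comp {P Q R : ColouredOperad} (f : ColouredOperad.Hom P Q)
    (g : ColouredOperad.Hom Q R) : ColouredOperad.Hom P R where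
  col c := g.col (f.col c)
  op x := g.op (f.op x)
  op_one c := by rw [f.op_one, g.op_one]
  op_comp x y := by rw [f.op_comp, g.op_comp]
  op_reindex := by
    intros
    rw [f.op_reindex, g.op_reindex]

/-- Symmetric coloured operads form a category. -/
instance : Category ColouredOperad where
  Hom := ColouredOperad.Hom
  id := ColouredOperad.Hom.id
  comp := ColouredOperad.Hom.comp

/-! ### Trees -/

/-- A non-empty finite rooted tree: finitely many edges and vertices, each vertex has an output
edge and a (possibly empty) set of input edges, each edge is the output of at most one vertex and
an input of at most one vertex, the root is the unique edge which is not an input of a vertex,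
and from each edge one gets down to the root by passing from an input of a vertex to its output.
(The set of vertices is finite since `out` is injective.) -/
structure Tree where
  Edge : Type
  Vert : Type
  finite_edge : Finite Edge
  root : Edge
  out : Vert → Edge
  ins : Vert → Set Edge
  out_inj : ∀ {v w : Vert}, out v = out w → v = w
  ins_unique : ∀ {v w : Vert} {a : Edge}, a ∈ ins v → a ∈ ins w → v = w
  exists_ins_iff : ∀ a : Edge, (∃ v, a ∈ ins v) ↔ a ≠ root
  connected : ∀ a : Edge, Relation.ReflTransGen (fun b c => ∃ v, b ∈ ins v ∧ out v = c) a root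

namespace Tree

variable (T : Tree)

instance : Finite T.Edge := T.finite_edge

instance : Finite T.Vert := Finite.of_injective T.out (fun _ _ h => T.out_inj h)

/-- The number `|T|` of vertices. -/
noncomputable def size : ℕ := Nat.card T.Vert

/-- `T.Step b c`: `b` is an input and `c` is the output of some vertex. -/
def Step (b c : T.Edge) : Prop := ∃ v, b ∈ T.ins v ∧ T.out v = c

/-- `T.Below a b`: the edge `a` lies on the path from the edge `b` down to the root
(including `a = b`). -/
def Below (a b : T.Edge) : Prop := Relation.ReflTransGen T.Step b a

/-- An edge is a leaf if it is not the output of a vertex. -/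
def IsLeaf (a : T.Edge) : Prop := ∀ u, T.out u ≠ a

variable {T}

theorem not_step_root {b : T.Edge} : ¬ T.Step T.root b := fun ⟨v, hv, _⟩ =>
  (T.exists_ins_iff _).1 ⟨v, hv⟩ rfl

theorem step_unique {a b c : T.Edge} (h : T.Step a b) (h' : T.Step a c) : b = c := by
  obtain ⟨v, hv, rfl⟩ := h
  obtain ⟨w, hw, rfl⟩ := h'
  rw [T.ins_unique hv hw]

theorem below_refl (a : T.Edge) : T.Below a a := Relation.ReflTransGen.refl

theorem below_trans {a b c : T.Edge} (h : T.Below a b) (h' : T.Below b c) : T.Below a c :=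
  Relation.ReflTransGen.trans h' h

theorem root_below (a : T.Edge) : T.Below T.root a := T.connected a

theorem out_below {v : T.Vert} {a : T.Edge} (h : a ∈ T.ins v) : T.Below (T.out v) a :=
  Relation.ReflTransGen.single ⟨v, h, rfl⟩

theorem not_transGen (a : T.Edge) : ¬ Relation.TransGen T.Step a a := by
  refine Relation.ReflTransGen.head_induction_on (motive := fun b _ =>
    ¬ Relation.TransGen T.Step b b) (T.connected a) ?_ ?_
  · intro h
    obtain ⟨c, hc, -⟩ := Relation.TransGen.head'_iff.1 h
    exact not_step_root hc
  · intro b c hbc _ ih h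
    obtain ⟨c', hc, h'⟩ := Relation.TransGen.head'_iff.1 h
    obtain rfl := step_unique hbc hc
    exact ih (Relation.TransGen.tail' h' hbc)

theorem below_antisymm {a b : T.Edge} (h : T.Below a b) (h' : T.Below b a) : a = b := by
  rcases Relation.reflTransGen_iff_eq_or_transGen.1 h with h1 | h1
  · exact h1
  · exact absurd (Relation.TransGen.trans_left h1 h') (not_transGen b)

theorem below_total {a b c : T.Edge} (h : T.Below a c) (h' : T.Below b c) :
    T.Below a b ∨ T.Below b a :=
  (Relation.ReflTransGen.total_of_right_unique (r := T.Step)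
    (fun _ _ _ => step_unique) h h').symm

theorem below_out_of_ne {a b : T.Edge} {v : T.Vert} (h : T.Below a b) (hb : b ∈ T.ins v)
    (hne : a ≠ b) : T.Below a (T.out v) := by
  rcases Relation.ReflTransGen.cases_head h with h1 | ⟨c, hc, h1⟩
  · exact absurd h1.symm hne
  · rwa [step_unique (⟨v, hb, rfl⟩ : T.Step b (T.out v)) hc]

theorem not_below_out {a : T.Edge} {v : T.Vert} (h : a ∈ T.ins v) : ¬ T.Below a (T.out v) :=
  fun h' => not_transGen a (Relation.TransGen.head' ⟨v, h, rfl⟩ h')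

theorem out_notMem_ins (v : T.Vert) : T.out v ∉ T.ins v :=
  fun h => not_below_out h (below_refl _)

theorem siblings_incomparable {v : T.Vert} {i j : T.Edge} (hi : i ∈ T.ins v)
    (hj : j ∈ T.ins v) (h : T.Below i j) : i = j := by
  by_contra hne
  exact not_below_out hi (below_out_of_ne h hj hne)

/-! ### The operad generated by a tree -/

/-- `T.Gen c e`: the vertices of `T` generate an operation with inputs `c` and output `e`. -/
inductive Gen (T : Tree) : (I : Type) → [Finite I] → (I → T.Edge) → T.Edge → Prop
  | one (e : T.Edge) : Gen T Unit (fun _ => e) e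
  | vertex (v : T.Vert) : Gen T (T.ins v) (fun a => a.1) (T.out v)
  | comp {I : Type} [Finite I] {J : I → Type} [∀ i, Finite (J i)] {c : I → T.Edge}
      {c₀ : T.Edge} {d : (i : I) → J i → T.Edge} (hx : Gen T I c c₀)
      (hy : ∀ i, Gen T (J i) (d i) (c i)) : Gen T (Σ i, J i) (fun k => d k.1 k.2) c₀
  | reindex {I J : Type} [Finite I] [Finite J] (σ : I ≃ J) {c : J → T.Edge} {c₀ : T.Edge}
      (hx : Gen T J c c₀) : Gen T I (fun i => c (σ i)) c₀

/-- The symmetric coloured operad `Ω(T)` freely generated by the vertices of `T`. Its colours are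
the edges of `T`. For each signature there is at most one operation (given by the subtree with
the given leaves and the given root), so that the set of operations is the truth value of the
proposition that the vertices generate an operation of this signature. -/
def operad (T : Tree) : ColouredOperad where
  Col := T.Edge
  Op I _ c c₀ := PLift (T.Gen I c c₀)
  one c := ⟨Gen.one c⟩
  comp x y := ⟨Gen.comp x.down (fun i => (y i).down)⟩
  reindex σ _ _ x := ⟨Gen.reindex σ x.down⟩
  reindex_refl _ := rfl
  reindex_trans _ _ _ _ _ := rfl
  comp_reindex_left := by intros; rfl
  comp_reindex_right := by intros; rfl
  one_comp _ := rfl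
  comp_one _ := rfl
  assoc _ _ _ := rfl

/-- The category `Ω` of trees, as a full subcategory of the category of coloured operads. -/
instance : Category Tree where
  Hom S T := ColouredOperad.Hom S.operad T.operad
  id T := ColouredOperad.Hom.id T.operad
  comp f g := ColouredOperad.Hom.comp f g

/-- The map on edges underlying a morphism of trees. -/
def edgeMap {S T : Tree} (f : S ⟶ T) : S.Edge → T.Edge := ColouredOperad.Hom.col f

@[simp] theorem edgeMap_id (T : Tree) (a : T.Edge) : edgeMap (𝟙 T) a = a := rfl

@[simp] theorem edgeMap_comp {R S T : Tree} (f : R ⟶ S) (g : S ⟶ T) (a : R.Edge) :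
    edgeMap (f ≫ g) a = edgeMap g (edgeMap f a) := rfl

theorem gen_map {S T : Tree} (f : S ⟶ T) {I : Type} [Finite I] {c : I → S.Edge} {e : S.Edge}
    (h : S.Gen I c e) : T.Gen I (fun i => edgeMap f (c i)) (edgeMap f e) :=
  (ColouredOperad.Hom.op f (PLift.up h)).down

/-- A morphism of trees is determined by its map on edges. -/
theorem hom_ext {S T : Tree} {f g : S ⟶ T} (h : ∀ a, edgeMap f a = edgeMap g a) : f = g := by
  obtain ⟨f, f', _, _, _⟩ := f
  obtain ⟨g, g', _, _, _⟩ := g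
  obtain rfl : f = g := funext h
  obtain rfl : @f' = @g' := by
    funext I _ c c₀ x
    exact congrArg PLift.up (Subsingleton.elim (f' x).down (g' x).down)
  rfl

/-- A morphism of trees given by a map on edges which sends each vertex of `S` to an operation
of the operad of `T`. -/
def homMk {S T : Tree} (f : S.Edge → T.Edge)
    (h : ∀ v, T.Gen (S.ins v) (fun a => f a.1) (f (S.out v))) : S ⟶ T :=
  have key : ∀ {I : Type} [Finite I] {c : I → S.Edge} {e : S.Edge}, S.Gen I c e →
      T.Gen I (fun i => f (c i)) (f e) := by
    intro I _ c e hg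
    induction hg with
    | one e => exact Gen.one _
    | vertex v => exact h v
    | comp _ _ ihx ihy => exact Gen.comp ihx ihy
    | reindex σ _ ih => exact Gen.reindex σ ih
  (⟨f, fun x => ⟨key x.down⟩, fun _ => rfl, fun _ _ => rfl, by intros; rfl⟩ :
    ColouredOperad.Hom S.operad T.operad)

@[simp] theorem edgeMap_homMk {S T : Tree} (f : S.Edge → T.Edge)
    (h : ∀ v, T.Gen (S.ins v) (fun a => f a.1) (f (S.out v))) (a : S.Edge) :
    edgeMap (homMk f h) a = f a := rfl

theorem Gen.of_equiv {T : Tree} {I J : Type} [Finite I] [Finite J] {c : I → T.Edge}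
    {d : J → T.Edge} {e e' : T.Edge} (h : T.Gen J d e) (σ : I ≃ J) (hc : ∀ i, c i = d (σ i))
    (he : e' = e) : T.Gen I c e' := by
  obtain rfl : c = fun i => d (σ i) := funext hc
  subst he
  exact Gen.reindex σ h

theorem Gen.of_bijective {T : Tree} {I J : Type} [Finite I] [Finite J] {c : I → T.Edge}
    {d : J → T.Edge} {e : T.Edge} (h : T.Gen J d e) (s : J → I) (hs : Function.Bijective s)
    (hc : ∀ j, c (s j) = d j) : T.Gen I c e := by
  refine h.of_equiv (Equiv.ofBijective s hs).symm (fun i => ?_) rfl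
  obtain ⟨j, rfl⟩ := hs.2 i
  rw [hc, Equiv.ofBijective_symm_apply_apply]

theorem Gen.below_inputs {T : Tree} {I : Type} [Finite I] {c : I → T.Edge} {e : T.Edge}
    (h : T.Gen I c e) : ∀ i, T.Below e (c i) := by
  induction h with
  | one e => exact fun _ => below_refl e
  | vertex v => exact fun a => out_below a.2
  | comp _ _ ihx ihy => exact fun k => below_trans (ihx k.1) (ihy k.1 k.2)
  | reindex σ _ ih => exact fun i => ih (σ i)

theorem Gen.incomparable {T : Tree} {I : Type} [Finite I] {c : I → T.Edge} {e : T.Edge}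
    (h : T.Gen I c e) : ∀ i j, T.Below (c i) (c j) → i = j := by
  induction h with
  | one e => exact fun _ _ _ => rfl
  | vertex v => exact fun a b hab => Subtype.ext (siblings_incomparable a.2 b.2 hab)
  | comp hx hy ihx ihy =>
    rintro ⟨i, j⟩ ⟨i', j'⟩ hb
    have h1 := (hy i).below_inputs j
    have h2 := (hy i').below_inputs j'
    have : i = i' := by
      rcases below_total (below_trans h1 hb) h2 with h3 | h3
      · exact ihx _ _ h3
      · exact (ihx _ _ h3).symm
    subst this
    rw [ihy i j j' hb]
  | reindex σ _ ih => exact fun i j hb => σ.injective (ih _ _ hb)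

theorem edgeMap_below {S T : Tree} (f : S ⟶ T) {a b : S.Edge} (h : S.Below a b) :
    T.Below (edgeMap f a) (edgeMap f b) := by
  induction h with
  | refl => exact below_refl _
  | tail _ hs ih =>
    obtain ⟨v, hv, rfl⟩ := hs
    exact below_trans ((gen_map f (Gen.vertex v)).below_inputs ⟨_, hv⟩) ih

theorem edgeMap_incomparable {S T : Tree} (f : S ⟶ T) {v : S.Vert} {a b : S.Edge}
    (ha : a ∈ S.ins v) (hb : b ∈ S.ins v) (h : T.Below (edgeMap f a) (edgeMap f b)) : a = b :=
  congrArg Subtype.val ((gen_map f (Gen.vertex v)).incomparable ⟨a, ha⟩ ⟨b, hb⟩ h)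

end Tree

/-! ### Planar structures -/

/-- A planar structure on a tree: a (strict) linear order on the set of inputs of each vertex. -/
@[ext] structure Planar (T : Tree) where
  lt : (v : T.Vert) → T.ins v → T.ins v → Prop
  irrefl : ∀ v i, ¬ lt v i i
  trans : ∀ v i j k, lt v i j → lt v j k → lt v i k
  total : ∀ v i j, i ≠ j → lt v i j ∨ lt v j i

namespace Planar

variable {T : Tree} (p : Planar T)

/-- `p.Left a b`: the edge `a` lies to the left of the edge `b`, i.e. there are two inputs `i < j`
of some vertex such that `a` is in the branch starting with `i` and `b` in the branch starting
with `j`. -/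
def Left (a b : T.Edge) : Prop :=
  ∃ (v : T.Vert) (i j : T.ins v), p.lt v i j ∧ T.Below i a ∧ T.Below j b

variable {p}

theorem Left.mono {a b a' b' : T.Edge} (h : p.Left a b) (ha : T.Below a a') (hb : T.Below b b') :
    p.Left a' b' := by
  obtain ⟨v, i, j, hij, hi, hj⟩ := h
  exact ⟨v, i, j, hij, Tree.below_trans hi ha, Tree.below_trans hj hb⟩

theorem Left.not_below {a b : T.Edge} (h : p.Left a b) : ¬ T.Below a b ∧ ¬ T.Below b a := by
  obtain ⟨v, i, j, hij, hi, hj⟩ := h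
  have key : ∀ c, T.Below i c → T.Below j c → False := by
    intro c h1 h2
    have : i = j := by
      rcases Tree.below_total h1 h2 with h3 | h3
      · exact Subtype.ext (Tree.siblings_incomparable i.2 j.2 h3)
      · exact (Subtype.ext (Tree.siblings_incomparable j.2 i.2 h3)).symm
    exact p.irrefl v i (this ▸ hij)
  exact ⟨fun h => key b (Tree.below_trans hi h) hj, fun h => key a hi (Tree.below_trans hj h)⟩

theorem Left.trans {a b c : T.Edge} (h : p.Left a b) (h' : p.Left b c) : p.Left a c := by
  obtain ⟨v, i, j, hij, hi, hj⟩ := h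
  obtain ⟨w, k, l, hkl, hk, hl⟩ := h'
  by_cases hjk : j.1 = k.1
  · obtain rfl : v = w := T.ins_unique j.2 (hjk ▸ k.2)
    obtain rfl : j = k := Subtype.ext hjk
    exact ⟨v, i, l, p.trans v _ _ _ hij hkl, hi, hl⟩
  · rcases Tree.below_total hj hk with h1 | h1
    · refine ⟨v, i, j, hij, hi, ?_⟩
      exact Tree.below_trans (Tree.below_out_of_ne h1 k.2 hjk)
        (Tree.below_trans (Tree.out_below l.2) hl)
    · refine ⟨w, k, l, hkl, ?_, hl⟩
      exact Tree.below_trans (Tree.below_out_of_ne h1 j.2 (Ne.symm hjk))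
        (Tree.below_trans (Tree.out_below i.2) hi)

theorem Left.irrefl {a : T.Edge} : ¬ p.Left a a := fun h => h.not_below.1 (Tree.below_refl a)

theorem Left.asymm {a b : T.Edge} (h : p.Left a b) : ¬ p.Left b a :=
  fun h' => Left.irrefl (h.trans h')

variable (p) in
theorem left_total {a b : T.Edge} (hab : ¬ T.Below a b) (hba : ¬ T.Below b a) :
    p.Left a b ∨ p.Left b a := by
  have key : ∀ c, Relation.ReflTransGen T.Step c T.root → T.Below c a → ¬ T.Below c b →
      ∃ v, ∃ i ∈ T.ins v, T.Below i a ∧ ¬ T.Below i b ∧ T.Below (T.out v) b := by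
    intro c hc
    induction hc using Relation.ReflTransGen.head_induction_on with
    | refl => exact fun _ h => absurd (Tree.root_below b) h
    | @head x y hs _ ih =>
      intro h1 h2
      by_cases hy : T.Below y b
      · obtain ⟨v, hv, rfl⟩ := hs
        exact ⟨v, x, hv, h1, h2, hy⟩
      · exact ih (Tree.below_trans (Relation.ReflTransGen.single hs) h1) hy
  obtain ⟨v, i, hi, h1, h2, h3⟩ := key a (T.connected a) (Tree.below_refl a) hab
  rcases Relation.ReflTransGen.cases_tail h3 with h4 | ⟨j, hj, ⟨w, hw, hwv⟩⟩
  · exact absurd (h4 ▸ Tree.below_trans (Tree.out_below hi) h1) hba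
  · obtain rfl := T.out_inj hwv
    have hne : (⟨i, hi⟩ : T.ins w) ≠ ⟨j, hw⟩ := by
      intro h
      have h' : i = j := congrArg Subtype.val h
      exact h2 (h' ▸ hj)
    rcases p.total w _ _ hne with h | h
    · exact Or.inl ⟨w, _, _, h, h1, hj⟩
    · exact Or.inr ⟨w, _, _, h, hj, h1⟩

/-- The planar structure `P(f)(p)` on `S` induced by a planar structure `p` on `T` along a
morphism `f : S ⟶ T`: two inputs of a vertex of `S` are compared by comparing their images, which
are two leaves of the subtree of `T` corresponding to the vertex, in the left-to-right order. -/
def pullback {S T : Tree} (f : S ⟶ T) (p : Planar T) : Planar S where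
  lt _ i j := p.Left (Tree.edgeMap f i) (Tree.edgeMap f j)
  irrefl _ _ := Left.irrefl
  trans _ _ _ _ h h' := h.trans h'
  total _ i j hij := p.left_total
    (fun h => hij (Subtype.ext (Tree.edgeMap_incomparable f i.2 j.2 h)))
    (fun h => hij (Subtype.ext (Tree.edgeMap_incomparable f j.2 i.2 h)).symm)

theorem lt_iff_left (p : Planar T) (v : T.Vert) (i j : T.ins v) : p.lt v i j ↔ p.Left i j := by
  refine ⟨fun h => ⟨v, i, j, h, Tree.below_refl _, Tree.below_refl _⟩, fun h => ?_⟩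
  have hij : i ≠ j := fun h' => Left.irrefl (h' ▸ h)
  rcases p.total v i j hij with h1 | h1
  · exact h1
  · exact absurd ⟨v, j, i, h1, Tree.below_refl _, Tree.below_refl _⟩ h.asymm

theorem left_pullback {S T : Tree} (f : S ⟶ T) (p : Planar T) {a b : S.Edge}
    (h : (pullback f p).Left a b) : p.Left (Tree.edgeMap f a) (Tree.edgeMap f b) := by
  obtain ⟨v, i, j, hij, hi, hj⟩ := h
  exact Left.mono hij (Tree.edgeMap_below f hi) (Tree.edgeMap_below f hj)

theorem pullback_comp {R S T : Tree} (f : R ⟶ S) (g : S ⟶ T) (p : Planar T) :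
    pullback (f ≫ g) p = pullback f (pullback g p) := by
  ext v i j
  refine ⟨fun h => ?_, fun h => (left_pullback g p h : p.Left _ _)⟩
  replace h : p.Left (Tree.edgeMap g (Tree.edgeMap f i)) (Tree.edgeMap g (Tree.edgeMap f j)) := h
  have hij : i ≠ j := fun h' => Left.irrefl (h' ▸ h)
  rcases (pullback f (pullback g p)).total v i j hij with h1 | h1
  · exact h1
  · exact absurd (left_pullback g p h1) (Left.asymm h)

theorem pullback_id (p : Planar T) : pullback (𝟙 T) p = p := by
  ext v i j
  exact (p.lt_iff_left v i j).symm

/-! ### The labelling of the vertices -/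

variable (p)

/-- The order in which the vertices of a planar tree get labelled: first a vertex, then all the
vertices of its leftmost branch, then all those of the second branch, and so on. So `u` comes
before `w` iff `u` is below `w`, or `u` is in a branch to the left of a branch that has `w`. -/
def Before (u w : T.Vert) : Prop :=
  (u ≠ w ∧ T.Below (T.out u) (T.out w)) ∨ p.Left (T.out u) (T.out w)

/-- The label of a vertex: the number of vertices which are labelled before it. So the vertices
get the labels `0, …, |T| - 1`. -/
noncomputable def label (w : T.Vert) : ℕ := Nat.card {u : T.Vert // p.Before u w}

variable {p}

theorem Before.irrefl {u : T.Vert} : ¬ p.Before u u := by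
  rintro (⟨h, -⟩ | h)
  · exact h rfl
  · exact Left.irrefl h

theorem Before.trans {u v w : T.Vert} (h : p.Before u v) (h' : p.Before v w) :
    p.Before u w := by
  rcases h with ⟨hn, h⟩ | h <;> rcases h' with ⟨hn', h'⟩ | h'
  · refine Or.inl ⟨?_, Tree.below_trans h h'⟩
    rintro rfl
    exact hn (T.out_inj (Tree.below_antisymm h h'))
  · obtain ⟨x, i, j, hij, hi, hj⟩ := h'
    rcases Tree.below_total h hi with h1 | h1
    · by_cases hne : T.out u = i.1
      · exact Or.inr ⟨x, i, j, hij, hne ▸ Tree.below_refl _, hj⟩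
      · have h2 := Tree.below_trans (Tree.below_out_of_ne h1 i.2 hne)
          (Tree.below_trans (Tree.out_below j.2) hj)
        refine Or.inl ⟨?_, h2⟩
        rintro rfl
        exact (Left.not_below ⟨x, i, j, hij, hi, hj⟩).2 h
    · exact Or.inr ⟨x, i, j, hij, h1, hj⟩
  · exact Or.inr (h.mono (Tree.below_refl _) h')
  · exact Or.inr (h.trans h')

variable (p) in
theorem before_total {u w : T.Vert} (h : u ≠ w) : p.Before u w ∨ p.Before w u := by
  by_cases h1 : T.Below (T.out u) (T.out w)
  · exact Or.inl (Or.inl ⟨h, h1⟩)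
  by_cases h2 : T.Below (T.out w) (T.out u)
  · exact Or.inr (Or.inl ⟨h.symm, h2⟩)
  exact (p.left_total h1 h2).imp Or.inr Or.inr

theorem label_lt_label {u w : T.Vert} (h : p.Before u w) : p.label u < p.label w :=
  Set.ncard_lt_ncard (s := {x | p.Before x u}) (t := {x | p.Before x w})
    ⟨fun _ hx => Before.trans hx h, fun hs => Before.irrefl (hs h)⟩ (Set.toFinite _)

variable (p) in
theorem label_lt (w : T.Vert) : p.label w < T.size := by
  have h : ({x | p.Before x w} : Set T.Vert) ⊂ Set.univ :=
    ⟨Set.subset_univ _, fun hs => Before.irrefl (hs (Set.mem_univ w))⟩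
  have := Set.ncard_lt_ncard h (Set.toFinite _)
  rwa [Set.ncard_univ] at this

theorem label_injective : Function.Injective p.label := by
  intro u w h
  by_contra hne
  rcases p.before_total hne with h1 | h1
  · exact absurd h (label_lt_label h1).ne
  · exact absurd h (label_lt_label h1).ne'

variable (p)

/-- The labelling as a bijection between the vertices and the set of labels. -/
noncomputable def labelEquiv : T.Vert ≃ Fin T.size :=
  Equiv.ofBijective (fun w => ⟨p.label w, p.label_lt w⟩) <| by
    have hinj : Function.Injective (fun w => (⟨p.label w, p.label_lt w⟩ : Fin T.size)) :=
      fun u w h => label_injective (congrArg Fin.val h)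
    exact (Nat.bijective_iff_injective_and_card _).2 ⟨hinj, by simp [Tree.size]⟩

/-- The sign `sgn(p', p)`: the sign of the permutation of the set of labels which sends the
label of each vertex with respect to `p'` to its label with respect to `p`. (The label `0` of the
root vertex is always fixed, so that it does not matter whether it is included.) -/
noncomputable def sgn (p' p : Planar T) : ℤˣ :=
  Equiv.Perm.sign (p'.labelEquiv.symm.trans p.labelEquiv)

end Planar

/-! ### Elementary faces -/

namespace Tree

variable (T : Tree)

/-- The elementary faces of a tree:
* for each inner edge, i.e. an edge `out w` that is both the output of a vertex `w` and an input
  of a vertex `v`, an inner face;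
* for each top vertex `w`, i.e. a vertex all of whose inputs are leaves, a top face;
* for each bottom vertex `v` with an input `e` such that all other inputs of `v` are leaves,
  a bottom face. -/
inductive Face
  | inner (v w : T.Vert) (h : T.out w ∈ T.ins v)
  | top (w : T.Vert) (h : ∀ a ∈ T.ins w, T.IsLeaf a)
  | bottom (v : T.Vert) (e : T.Edge) (hv : T.out v = T.root) (he : e ∈ T.ins v)
      (h : ∀ a ∈ T.ins v, a ≠ e → T.IsLeaf a)

instance : Finite T.Face := by
  refine Finite.of_injective (β := (T.Vert × T.Vert) ⊕ T.Vert ⊕ (T.Vert × T.Edge))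
    (fun f => match f with
      | .inner v w _ => .inl (v, w)
      | .top w _ => .inr (.inl w)
      | .bottom v e _ _ _ => .inr (.inr (v, e))) ?_
  intro f g h
  cases f <;> cases g <;> simp_all

noncomputable instance : Fintype T.Face := Fintype.ofFinite _

variable {T}

/-- Contracting the inner edge `out w`: the vertices `v` and `w` are merged to a single vertex
(which is still called `v`), whose inputs are the inputs of `v` other than `out w` and the inputs
of `w`. -/
def innerFace (v w : T.Vert) (h : T.out w ∈ T.ins v) : Tree where
  Edge := {a : T.Edge // a ≠ T.out w}
  Vert := {u : T.Vert // u ≠ w}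
  finite_edge := inferInstance
  root := ⟨T.root, fun h' => (T.exists_ins_iff _).1 ⟨v, h⟩ h'.symm⟩
  out u := ⟨T.out u.1, fun h' => u.2 (T.out_inj h')⟩
  ins u := {a | a.1 ∈ T.ins u.1 ∨ (u.1 = v ∧ a.1 ∈ T.ins w)}
  out_inj h' := Subtype.ext (T.out_inj (congrArg Subtype.val h'))
  ins_unique := by
    rintro ⟨u, hu⟩ ⟨u', hu'⟩ ⟨a, ha⟩ h1 h2
    apply Subtype.ext
    rcases h1 with h1 | ⟨h1, h1'⟩ <;> rcases h2 with h2 | ⟨h2, h2'⟩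
    · exact T.ins_unique h1 h2
    · exact absurd (T.ins_unique h1 h2') hu
    · exact absurd (T.ins_unique h2 h1') hu'
    · exact h1.trans h2.symm
  exists_ins_iff := by
    rintro ⟨a, ha⟩
    rw [Ne, Subtype.mk.injEq, ← Ne, ← T.exists_ins_iff]
    constructor
    · rintro ⟨u, h1 | ⟨-, h1⟩⟩
      · exact ⟨_, h1⟩
      · exact ⟨_, h1⟩
    · rintro ⟨u, hu⟩
      by_cases huw : u = w
      · subst huw
        exact ⟨⟨v, fun h' => T.out_notMem_ins v (h' ▸ h)⟩, Or.inr ⟨rfl, hu⟩⟩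
      · exact ⟨⟨u, huw⟩, Or.inl hu⟩
  connected := by
    have hvw : v ≠ w := fun h' => T.out_notMem_ins v (h' ▸ h)
    rintro ⟨a, ha⟩
    suffices H : ∀ b, Relation.ReflTransGen T.Step b T.root → ∀ (c : {a : T.Edge // a ≠ T.out w}),
        (b = c.1 ∨ (b = T.out w ∧ c.1 = T.out v)) → Relation.ReflTransGen
        (fun (b c : {a : T.Edge // a ≠ T.out w}) => ∃ u : {u : T.Vert // u ≠ w},
          (b.1 ∈ T.ins u.1 ∨ (u.1 = v ∧ b.1 ∈ T.ins w)) ∧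
            (⟨T.out u.1, fun h' => u.2 (T.out_inj h')⟩ : {a : T.Edge // a ≠ T.out w}) = c) c
        ⟨T.root, fun h' => (T.exists_ins_iff _).1 ⟨v, h⟩ h'.symm⟩ from
      H a (T.connected a) ⟨a, ha⟩ (Or.inl rfl)
    intro b hb
    induction hb using Relation.ReflTransGen.head_induction_on with
    | refl =>
      rintro c (h1 | ⟨h1, -⟩)
      · obtain ⟨c, hc⟩ := c
        obtain rfl : T.root = c := h1
        exact Relation.ReflTransGen.refl
      · exact absurd h1.symm ((T.exists_ins_iff _).1 ⟨v, h⟩)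
    | @head x y hs _ ih =>
      obtain ⟨u, hu, rfl⟩ := hs
      rintro ⟨c, hc⟩ (h1 | ⟨h1, h2⟩)
      · obtain rfl : x = c := h1
        by_cases huw : u = w
        · subst huw
          exact Relation.ReflTransGen.head ⟨⟨v, hvw⟩, Or.inr ⟨rfl, hu⟩, rfl⟩
            (ih _ (Or.inr ⟨rfl, rfl⟩))
        · exact Relation.ReflTransGen.head ⟨⟨u, huw⟩, Or.inl hu, rfl⟩ (ih _ (Or.inl rfl))
      · obtain rfl : c = T.out v := h2
        subst h1
        obtain rfl : u = v := T.ins_unique hu h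
        exact ih _ (Or.inl rfl)

/-- Chopping off the top vertex `w` with all its inputs. -/
def topFace (w : T.Vert) (h : ∀ a ∈ T.ins w, T.IsLeaf a) : Tree where
  Edge := {a : T.Edge // a ∉ T.ins w}
  Vert := {u : T.Vert // u ≠ w}
  finite_edge := inferInstance
  root := ⟨T.root, fun h' => (T.exists_ins_iff _).1 ⟨w, h'⟩ rfl⟩
  out u := ⟨T.out u.1, fun h' => h _ h' u.1 rfl⟩
  ins u := {a | a.1 ∈ T.ins u.1}
  out_inj h' := Subtype.ext (T.out_inj (congrArg Subtype.val h'))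
  ins_unique h1 h2 := Subtype.ext (T.ins_unique h1 h2)
  exists_ins_iff := by
    rintro ⟨a, ha⟩
    rw [Ne, Subtype.mk.injEq, ← Ne, ← T.exists_ins_iff]
    constructor
    · rintro ⟨u, h1⟩
      exact ⟨_, h1⟩
    · rintro ⟨u, hu⟩
      exact ⟨⟨u, fun h' => ha (h' ▸ hu)⟩, hu⟩
  connected := by
    rintro ⟨a, ha⟩
    have hb := T.connected a
    induction hb using Relation.ReflTransGen.head_induction_on with
    | refl => exact Relation.ReflTransGen.refl
    | head hs _ ih =>
      obtain ⟨u, hu, rfl⟩ := hs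
      exact Relation.ReflTransGen.head
        ⟨⟨u, fun h' => ha (h' ▸ hu)⟩, hu, rfl⟩ (ih (fun h' => h _ h' u rfl))

/-- Chopping off the bottom vertex `v` with the root and all its inputs except `e`. -/
def bottomFace (v : T.Vert) (e : T.Edge) (hv : T.out v = T.root) (he : e ∈ T.ins v)
    (h : ∀ a ∈ T.ins v, a ≠ e → T.IsLeaf a) : Tree where
  Edge := {a : T.Edge // a ≠ T.root ∧ (a ∈ T.ins v → a = e)}
  Vert := {u : T.Vert // u ≠ v}
  finite_edge := inferInstance
  root := ⟨e, (T.exists_ins_iff _).1 ⟨v, he⟩, fun _ => rfl⟩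
  out u := ⟨T.out u.1, fun h' => u.2 (T.out_inj (h'.trans hv.symm)),
    fun h' => by_contra fun hne => h _ h' hne u.1 rfl⟩
  ins u := {a | a.1 ∈ T.ins u.1}
  out_inj h' := Subtype.ext (T.out_inj (congrArg Subtype.val h'))
  ins_unique h1 h2 := Subtype.ext (T.ins_unique h1 h2)
  exists_ins_iff := by
    rintro ⟨a, ha, ha'⟩
    constructor
    · rintro ⟨u, h1⟩ h'
      obtain rfl : a = e := congrArg Subtype.val h'
      exact u.2 (T.ins_unique h1 he)
    · intro hae'
      have hae : a ≠ e := fun h' => hae' (Subtype.ext h')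
      obtain ⟨u, hu⟩ := (T.exists_ins_iff a).2 ha
      exact ⟨⟨u, fun h' => hae (ha' (h' ▸ hu))⟩, hu⟩
  connected := by
    rintro ⟨a, ha, ha'⟩
    have hb := T.connected a
    induction hb using Relation.ReflTransGen.head_induction_on with
    | refl => exact absurd rfl ha
    | @head x y hs _ ih =>
      obtain ⟨u, hu, rfl⟩ := hs
      by_cases huv : u = v
      · subst huv
        obtain rfl := ha' hu
        exact Relation.ReflTransGen.refl
      · exact Relation.ReflTransGen.head ⟨⟨u, huv⟩, hu, rfl⟩
          (ih (fun h' => huv (T.out_inj (h'.trans hv.symm)))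
            (fun h' => by_contra fun hne => h _ h' hne u rfl))

/-- The tree `∂_f T`. -/
def Face.tree : T.Face → Tree
  | .inner v w h => innerFace v w h
  | .top w h => topFace w h
  | .bottom v e hv he h => bottomFace v e hv he h

theorem card_vert_ne {n : ℕ} (hn : T.size = n + 1) (w : T.Vert) :
    Nat.card {u : T.Vert // u ≠ w} = n := by
  classical
  have := Fintype.ofFinite T.Vert
  rw [size, Nat.card_eq_fintype_card] at hn
  rw [Nat.card_eq_fintype_card, Fintype.card_subtype_compl, Fintype.card_subtype_eq, hn]
  rfl

/-- An elementary face has one vertex less. -/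
theorem Face.size_tree {n : ℕ} (hn : T.size = n + 1) (f : T.Face) : f.tree.size = n := by
  cases f <;> exact card_vert_ne hn _

/-- The inclusion `∂_e T ⟶ T` of an inner face. The vertex `v` of `∂_e T` is sent to the
composition `v ∘_e w`. -/
noncomputable def innerIncl (v w : T.Vert) (h : T.out w ∈ T.ins v) : innerFace v w h ⟶ T :=
  homMk (S := innerFace v w h) Subtype.val <| by
    rintro ⟨u, hu⟩
    by_cases huv : u = v
    · subst huv
      let J : T.ins u → Type := fun i =>
        {a : T.Edge // (i.1 = T.out w ∧ a ∈ T.ins w) ∨ (i.1 ≠ T.out w ∧ a = i.1)}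
      have hJ : ∀ i : T.ins u, T.Gen (J i) (fun a => a.1) i.1 := by
        rintro ⟨i, hi⟩
        by_cases hiw : i = T.out w
        · refine (Gen.vertex w).of_equiv
            (Equiv.subtypeEquivRight (fun a => ?_)) (fun _ => rfl) hiw
          simp [hiw]
        · refine (Gen.one i).of_equiv (⟨fun _ => (), fun _ => ⟨i, Or.inr ⟨hiw, rfl⟩⟩,
            ?_, fun _ => rfl⟩) ?_ rfl
          · rintro ⟨a, ha | ha⟩
            · exact absurd ha.1 hiw
            · exact Subtype.ext ha.2.symm
          · rintro ⟨a, ha | ha⟩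
            · exact absurd ha.1 hiw
            · exact ha.2
      have h1 : ∀ k : Σ i, J i, k.2.1 ≠ T.out w := by
        rintro ⟨⟨i, hi⟩, ⟨a, h1 | h1⟩⟩
        · exact fun h' => T.out_notMem_ins w (h' ▸ h1.2)
        · exact fun h' => h1.1 (h1.2.symm.trans h')
      have h2 : ∀ k : Σ i, J i, k.2.1 ∈ T.ins u ∨ (u = u ∧ k.2.1 ∈ T.ins w) := by
        rintro ⟨⟨i, hi⟩, ⟨a, h1 | h1⟩⟩
        · exact Or.inr ⟨rfl, h1.2⟩
        · exact Or.inl (h1.2.symm ▸ hi)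
      refine (Gen.comp (Gen.vertex u) hJ).of_bijective
        (fun k => ⟨⟨k.2.1, h1 k⟩, h2 k⟩) ⟨?_, ?_⟩ (fun _ => rfl)
      · rintro ⟨⟨i, hi⟩, ⟨a, ha⟩⟩ ⟨⟨i', hi'⟩, ⟨a', ha'⟩⟩ haa
        obtain rfl : a = a' := congrArg (fun x => x.1.1) haa
        obtain rfl : i = i' := by
          rcases ha with ha | ha <;> rcases ha' with ha' | ha'
          · exact ha.1.trans ha'.1.symm
          · have hm : a ∈ T.ins u := ha'.2.symm ▸ hi'
            exact absurd (T.ins_unique hm ha.2) hu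
          · have hm : a ∈ T.ins u := ha.2.symm ▸ hi
            exact absurd (T.ins_unique hm ha'.2) hu
          · exact ha.2.symm.trans ha'.2
        rfl
      · rintro ⟨⟨a, ha⟩, h1 | ⟨-, h1⟩⟩
        · exact ⟨⟨⟨a, h1⟩, ⟨a, Or.inr ⟨ha, rfl⟩⟩⟩, rfl⟩
        · exact ⟨⟨⟨_, h⟩, ⟨a, Or.inl ⟨rfl, h1⟩⟩⟩, rfl⟩
    · refine (Gen.vertex u).of_equiv ⟨fun a => ⟨a.1.1, a.2.resolve_right fun h' => huv h'.1⟩,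
        fun a => ⟨⟨a.1, fun h' => huv (T.ins_unique a.2 (h'.symm ▸ h))⟩, Or.inl a.2⟩,
        fun _ => rfl, fun _ => rfl⟩ (fun _ => rfl) rfl

/-- The inclusion of a top face. -/
def topIncl (w : T.Vert) (h : ∀ a ∈ T.ins w, T.IsLeaf a) : topFace w h ⟶ T :=
  homMk (S := topFace w h) Subtype.val <| by
    rintro ⟨u, hu⟩
    exact (Gen.vertex u).of_equiv ⟨fun a => ⟨a.1.1, a.2⟩,
      fun a => ⟨⟨a.1, fun h' => hu (T.ins_unique a.2 h')⟩, a.2⟩,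
      fun _ => rfl, fun _ => rfl⟩ (fun _ => rfl) rfl

/-- The inclusion of a bottom face. -/
def bottomIncl (v : T.Vert) (e : T.Edge) (hv : T.out v = T.root) (he : e ∈ T.ins v)
    (h : ∀ a ∈ T.ins v, a ≠ e → T.IsLeaf a) : bottomFace v e hv he h ⟶ T :=
  homMk (S := bottomFace v e hv he h) Subtype.val <| by
    rintro ⟨u, hu⟩
    exact (Gen.vertex u).of_equiv ⟨fun a => ⟨a.1.1, a.2⟩,
      fun a => ⟨⟨a.1, (T.exists_ins_iff _).1 ⟨u, a.2⟩,
        fun h' => absurd (T.ins_unique a.2 h') hu⟩, a.2⟩,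
      fun _ => rfl, fun _ => rfl⟩ (fun _ => rfl) rfl

/-- The elementary face map `∂_f : ∂_f T ⟶ T`. -/
noncomputable def Face.incl : (f : T.Face) → (f.tree ⟶ T)
  | .inner v w h => innerIncl v w h
  | .top w h => topIncl w h
  | .bottom v e hv he h => bottomIncl v e hv he h

/-- The sign `sgn_p(∂_f)` of an elementary face map with respect to a planar structure:
`(-1)^k` for an inner edge whose upper vertex has the label `k`, `(-1)^(k+1)` for a top vertex with
the label `k`, and `1` for a bottom face. In particular, for a corolla the inclusion of the root
has the sign `-1` (the only vertex is a top vertex with the label `0`) and the inclusion of a leaf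
has the sign `1`. -/
noncomputable def Face.sgn (p : Planar T) : T.Face → ℤ
  | .inner _ w _ => (-1) ^ p.label w
  | .top w _ => (-1) ^ (p.label w + 1)
  | .bottom _ _ _ _ _ => 1

/-! ### Elementary degeneracies -/

open Classical in
/-- The tree `σ_e T`, obtained by adding a copy `e'` of the edge `e` (the edge `none`) above `e`
and a unary vertex (the vertex `none`) with input `e'` and output `e`. If `e` is the output of a
vertex in `T`, then the output of this vertex in `σ_e T` is `e'`. -/
noncomputable def degen (T : Tree) (e : T.Edge) : Tree where
  Edge := Option T.Edge
  Vert := Option T.Vert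
  finite_edge := inferInstance
  root := some T.root
  out
    | none => some e
    | some v => if T.out v = e then none else some (T.out v)
  ins
    | none => {none}
    | some v => some '' T.ins v
  out_inj := by
    rintro (_ | v) (_ | w) h
    · rfl
    · simp only at h
      split_ifs at h with h1
      exact absurd (Option.some.inj h).symm h1
    · simp only at h
      split_ifs at h with h1
      exact absurd (Option.some.inj h) h1
    · simp only at h
      split_ifs at h with h1 h2 h2
      · exact congrArg some (T.out_inj (h1.trans h2.symm))
      · exact congrArg some (T.out_inj (Option.some.inj h))
  ins_unique := by
    rintro (_ | v) (_ | w) a h h'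
    · rfl
    · obtain ⟨b, -, rfl⟩ := h'
      simp at h
    · obtain ⟨b, -, rfl⟩ := h
      simp at h'
    · obtain ⟨b, hb, rfl⟩ := h
      obtain ⟨c, hc, hbc⟩ := h'
      obtain rfl := Option.some.inj hbc
      exact congrArg some (T.ins_unique hb hc)
  exists_ins_iff := by
    rintro (_ | a)
    · exact ⟨fun _ => by simp, fun _ => ⟨none, rfl⟩⟩
    · rw [Ne, Option.some.injEq, ← Ne, ← T.exists_ins_iff]
      constructor
      · rintro ⟨_ | v, h⟩
        · simp at h
        · obtain ⟨b, hb, hba⟩ := h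
          exact ⟨v, Option.some.inj hba ▸ hb⟩
      · rintro ⟨v, hv⟩
        exact ⟨some v, a, hv, rfl⟩
  connected := by
    intro a
    have key : ∀ b, Relation.ReflTransGen T.Step b T.root → Relation.ReflTransGen
        (fun (b c : Option T.Edge) => ∃ v : Option T.Vert,
          b ∈ (match v with
            | none => ({none} : Set (Option T.Edge))
            | some v => some '' T.ins v) ∧
          (match v with
            | none => some e
            | some v => if T.out v = e then none else some (T.out v)) = c)
        (some b) (some T.root) := by
      intro b hb
      induction hb using Relation.ReflTransGen.head_induction_on with
      | refl => exact Relation.ReflTransGen.refl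
      | @head x y hs _ ih =>
        obtain ⟨u, hu, rfl⟩ := hs
        by_cases hue : T.out u = e
        · refine Relation.ReflTransGen.head (b := none) ⟨some u, ⟨x, hu, rfl⟩, if_pos hue⟩ ?_
          exact Relation.ReflTransGen.head ⟨none, rfl, rfl⟩ (hue ▸ ih)
        · exact Relation.ReflTransGen.head ⟨some u, ⟨x, hu, rfl⟩, if_neg hue⟩ ih
    cases a with
    | none => exact Relation.ReflTransGen.head ⟨none, rfl, rfl⟩ (key e (T.connected e))
    | some a => exact key a (T.connected a)

open Classical in
/-- The elementary degeneracy map `σ_e : σ_e T ⟶ T`, which sends `e` and its copy to `e` and the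
new unary vertex to the identity operation. -/
noncomputable def degenMap (T : Tree) (e : T.Edge) : T.degen e ⟶ T :=
  homMk (S := T.degen e) (fun a => Option.getD a e) <| by
    rintro (_ | v)
    · refine (Gen.one e).of_equiv (J := Unit) ⟨fun _ => (), fun _ => ⟨none, rfl⟩, ?_,
        fun _ => rfl⟩ ?_ rfl
      · rintro ⟨a, ha⟩
        obtain rfl : a = none := ha
        rfl
      · rintro ⟨a, ha⟩
        obtain rfl : a = none := ha
        rfl
    · have ho : Option.getD ((T.degen e).out (some v)) e = T.out v := by
        change Option.getD (ite (T.out v = e) none (some (T.out v))) e = T.out v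
        split_ifs with h
        · exact h.symm
        · rfl
      rw [ho]
      refine (Gen.vertex v).of_bijective (fun a => ⟨some a.1, a.1, a.2, rfl⟩) ⟨?_, ?_⟩
        (fun _ => rfl)
      · intro a b hab
        exact Subtype.ext (Option.some.inj (congrArg Subtype.val hab))
      · rintro ⟨_, a, ha, rfl⟩
        exact ⟨⟨a, ha⟩, rfl⟩

end Tree

/-! ### The complex of a dendroidal set -/

/-- A dendroidal set is a presheaf of sets on the category of trees. -/
abbrev DendroidalSet : Type _ := Treeᵒᵖ ⥤ Type u

/-- The dendroidal set `P` of planar structures. -/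
def planarPresheaf : DendroidalSet where
  obj T := Planar T.unop
  map f := ↾ (Planar.pullback f.unop)
  map_id T := by
    refine ConcreteCategory.hom_ext _ _ (fun p => ?_)
    exact Planar.pullback_id p
  map_comp f g := by
    refine ConcreteCategory.hom_ext _ _ (fun p => ?_)
    exact Planar.pullback_comp g.unop f.unop p

variable (X : DendroidalSet.{u})

/-- The dendrex `f^* x`. -/
def DendroidalSet.restrict {X : DendroidalSet.{u}} {S T : Tree} (f : S ⟶ T)
    (x : X.obj (Opposite.op T)) : X.obj (Opposite.op S) := X.map f.op x

/-- A triple `(T, p, x)` of a tree with `n` vertices, a planar structure and a dendrex `x ∈ X_T`. -/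
structure PlanarDendrex (n : ℕ) where
  tree : Tree
  size_tree : tree.size = n
  planar : Planar tree
  dendrex : X.obj (Opposite.op tree)

/-- The free abelian group `C(X)_n` generated by the triples `(T, p, x)` with `|T| = n`. -/
abbrev C (n : ℕ) := FreeAbelianGroup (PlanarDendrex X n)

/-- The subgroup `A(X)_n` of `C(X)_n` generated by the elements
`(T, p, x) - sgn(p', τ^* p) (T', p', τ^* x)` for isomorphisms `τ : T' ⟶ T`. -/
def A (n : ℕ) : AddSubgroup (C X n) :=
  AddSubgroup.closure {y | ∃ (T T' : Tree) (hT : T.size = n) (hT' : T'.size = n)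
    (p : Planar T) (p' : Planar T') (τ : T' ≅ T) (x : X.obj (Opposite.op T)),
    y = FreeAbelianGroup.of ⟨T, hT, p, x⟩ -
      ((Planar.sgn p' (Planar.pullback τ.hom p) : ℤˣ) : ℤ) •
        FreeAbelianGroup.of ⟨T', hT', p', DendroidalSet.restrict τ.hom x⟩}

/-- The abelian group `Ch^un(X)_n`. -/
abbrev Chun (n : ℕ) := C X n ⧸ A X n

variable {X}

/-- The class `[T, p, x]`. -/
def PlanarDendrex.cls {n : ℕ} (g : PlanarDendrex X n) : Chun X n :=
  QuotientAddGroup.mk (FreeAbelianGroup.of g)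

/-- The triple `(∂_f T, p_f, ∂_f^* x)`. -/
noncomputable def PlanarDendrex.face {n : ℕ} (g : PlanarDendrex X (n + 1)) (f : g.tree.Face) :
    PlanarDendrex X n where
  tree := f.tree
  size_tree := f.size_tree g.size_tree
  planar := Planar.pullback f.incl g.planar
  dendrex := DendroidalSet.restrict f.incl g.dendrex

/-- A dendrex is degenerate if it is in the image of `σ^*` for an elementary degeneracy map `σ`
(composed with an isomorphism onto its source). -/
def IsDegenerate {T : Tree} (x : X.obj (Opposite.op T)) : Prop :=
  ∃ (S : Tree) (e : S.Edge) (α : T ≅ S.degen e) (y : X.obj (Opposite.op S)),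
    x = DendroidalSet.restrict (α.hom ≫ S.degenMap e) y

variable (X)

/-- The subgroup `D(X)_n` of `Ch^un(X)_n` generated by the classes of degenerate dendrices. -/
def D (n : ℕ) : AddSubgroup (Chun X n) :=
  AddSubgroup.closure {y | ∃ g : PlanarDendrex X n, IsDegenerate g.dendrex ∧ y = g.cls}

/-- A family of homomorphisms `d : Ch^un(X)_{n+1} → Ch^un(X)_n` is given on the generators by the
signed sum of the elementary faces. -/
def IsFaceDifferential (d : ∀ n : ℕ, Chun X (n + 1) →+ Chun X n) : Prop :=
  ∀ (n : ℕ) (g : PlanarDendrex X (n + 1)),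
    d n g.cls = ∑ f : g.tree.Face, f.sgn g.planar • (g.face f).cls

end Dendroidal

/-!
A morphism of trees which is injective on edges is determined, up to a unique isomorphism of its
source, by the edges in its image and by the outputs of the vertices of its source. Hence an
iterated elementary face of `T` can be described inside `T` by its edges and vertices, and an
elementary face is given by the vertex which it leaves out together with the way in which it
leaves it out.

Leaving out a vertex with the labels `k` and `k'` changes the sign relating two planar structures
by `(-1) ^ (k + k')`, which is the quotient of the two signs of the face. So the signed sum of the
faces does not depend on the planar structure, and it descends to `Ch^un(X)`.

The summands of `d (d [T, p, x])` cancel in pairs. In general the two vertices can be left out in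
the opposite order, which shifts one of the labels by one. The two exceptions are a pair of
adjacent vertices one of which ends up at the boundary, so that contracting the edge between them
and chopping off the two vertices one by one give the same result.

The tree `σ_e S` has exactly two faces which are sections of `σ_e` up to isomorphism, leaving out
either `e` or its copy. They cancel because the corresponding labels differ by one, while all
other faces of a degenerate dendrex are degenerate.
-/

namespace Dendroidal

open CategoryTheory

namespace Tree

/-! ### Embeddings of trees -/

theorem root_notMem_ins {T : Tree} (v : T.Vert) : T.root ∉ T.ins v :=
  fun h => (T.exists_ins_iff _).1 ⟨v, h⟩ rfl

theorem mem_ins_iff_covers {T : Tree} {v : T.Vert} {a : T.Edge} :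
    a ∈ T.ins v ↔ T.Below (T.out v) a ∧ a ≠ T.out v ∧
      ∀ c, T.Below (T.out v) c → T.Below c a → c = T.out v ∨ c = a := by
  constructor
  · intro h
    refine ⟨out_below h, fun h' => out_notMem_ins v (h' ▸ h), fun c h1 h2 => ?_⟩
    by_cases hc : c = a
    · exact Or.inr hc
    · exact Or.inl (below_antisymm (below_out_of_ne h2 h hc) h1)
  · rintro ⟨hle, hne, hcov⟩
    rcases Relation.ReflTransGen.cases_head hle with h | ⟨c, ⟨u, hu, rfl⟩, hc⟩
    · exact absurd h hne
    · rcases hcov _ hc (out_below hu) with h | h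
      · rwa [← T.out_inj h]
      · exact absurd (h ▸ hu) (out_notMem_ins u)

instance (T : Tree) : Nonempty (Planar T) :=
  ⟨{ lt := fun _ => WellOrderingRel
     irrefl := fun v i => irrefl_of (WellOrderingRel (α := T.ins v)) i
     trans := fun v _ _ _ h h' => trans_of (WellOrderingRel (α := T.ins v)) h h'
     total := fun v i j h => (trichotomous_of (WellOrderingRel (α := T.ins v)) i j).imp_right
       fun h' => h'.resolve_left h }⟩

-- Incomparable edges are to the left or right of each other for some planar structure, and stay so.
theorem below_edgeMap_iff {S T : Tree} {f : S ⟶ T} (hf : Function.Injective (edgeMap f))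
    {a b : S.Edge} : T.Below (edgeMap f a) (edgeMap f b) ↔ S.Below a b := by
  refine ⟨fun h => ?_, edgeMap_below f⟩
  by_contra hab
  obtain ⟨p⟩ : Nonempty (Planar T) := inferInstance
  by_cases hba : S.Below b a
  · exact hab (hf (below_antisymm h (edgeMap_below f hba)) ▸ below_refl a)
  · rcases (Planar.pullback f p).left_total hab hba with hl | hl
    · exact (Planar.left_pullback f p hl).not_below.1 h
    · exact (Planar.left_pullback f p hl).not_below.2 h

theorem gen_ins_of_orderIso {S S' : Tree} (σ : S.Edge ≃ S'.Edge)
    (hb : ∀ a b, S'.Below (σ a) (σ b) ↔ S.Below a b)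
    (ho : ∀ v, ∃ v', S'.out v' = σ (S.out v)) (v : S.Vert) :
    S'.Gen (S.ins v) (fun a => σ a.1) (σ (S.out v)) := by
  obtain ⟨v', hv'⟩ := ho v
  have h : ∀ a, a ∈ S.ins v ↔ σ a ∈ S'.ins v' := by
    intro a
    rw [mem_ins_iff_covers, mem_ins_iff_covers, hv', hb, σ.injective.ne_iff]
    refine and_congr_right fun _ => and_congr_right fun _ => ?_
    rw [← σ.forall_congr_right]
    simp only [hb, σ.injective.eq_iff]
  exact (Gen.vertex v').of_equiv (σ.subtypeEquiv h) (fun _ => rfl) hv'.symm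

/-- An order isomorphism between the edges of two trees which matches the outputs of the vertices,
as an isomorphism of trees. -/
def isoOfOrderIso {S S' : Tree} (σ : S.Edge ≃ S'.Edge)
    (hb : ∀ a b, S'.Below (σ a) (σ b) ↔ S.Below a b)
    (ho : ∀ v, ∃ v', S'.out v' = σ (S.out v)) (ho' : ∀ v', ∃ v, σ (S.out v) = S'.out v') :
    S ≅ S' where
  hom := homMk σ (gen_ins_of_orderIso σ hb ho)
  inv := homMk σ.symm (gen_ins_of_orderIso σ.symm
    (fun a b => by rw [← hb, σ.apply_symm_apply, σ.apply_symm_apply])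
    (fun v' => (ho' v').imp fun v hv => by rw [← hv, σ.symm_apply_apply]))
  hom_inv_id := hom_ext fun a => σ.symm_apply_apply a
  inv_hom_id := hom_ext fun a => σ.apply_symm_apply a

theorem exists_iso_of_range_eq {S S' : Tree} {E : Type} {r : E → E → Prop}
    {φ : S.Edge → E} {ψ : S'.Edge → E}
    (hφ : Function.Injective φ) (hψ : Function.Injective ψ)
    (hbφ : ∀ a b, r (φ a) (φ b) ↔ S.Below a b) (hbψ : ∀ a b, r (ψ a) (ψ b) ↔ S'.Below a b)
    (hr : Set.range φ = Set.range ψ)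
    (ho : Set.range (fun v => φ (S.out v)) = Set.range (fun v => ψ (S'.out v))) :
    ∃ α : S ≅ S', ∀ a, ψ (edgeMap α.hom a) = φ a := by
  let σ : S.Edge ≃ S'.Edge := (Equiv.ofInjective φ hφ).trans
    ((Equiv.setCongr hr).trans (Equiv.ofInjective ψ hψ).symm)
  have hσ : ∀ a, ψ (σ a) = φ a := fun a => Equiv.apply_ofInjective_symm hψ _
  refine ⟨isoOfOrderIso σ (fun a b => ?_) (fun v => ?_) (fun v' => ?_), hσ⟩
  · rw [← hbφ, ← hbψ, hσ, hσ]
  · obtain ⟨v', hv'⟩ : φ (S.out v) ∈ Set.range (fun v => ψ (S'.out v)) := ho ▸ ⟨v, rfl⟩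
    exact ⟨v', hψ (by rw [hσ]; exact hv')⟩
  · obtain ⟨v, hv⟩ : ψ (S'.out v') ∈ Set.range (fun v => φ (S.out v)) := ho ▸ ⟨v', rfl⟩
    exact ⟨v, hψ (by rw [hσ]; exact hv)⟩

theorem Gen.exists_input_or_out {T : Tree} {I : Type} [Finite I] {c : I → T.Edge} {e : T.Edge}
    (h : T.Gen I c e) : (∃ i, c i = e) ∨ ∃ v, T.out v = e := by
  induction h with
  | one e => exact Or.inl ⟨(), rfl⟩
  | vertex v => exact Or.inr ⟨v, rfl⟩
  | comp _ _ ihx ihy =>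
    rcases ihx with ⟨i, hi⟩ | h
    · rcases ihy i with ⟨j, hj⟩ | ⟨v, hv⟩
      · exact Or.inl ⟨⟨i, j⟩, hj.trans hi⟩
      · exact Or.inr ⟨v, hv.trans hi⟩
    · exact Or.inr h
  | reindex σ _ ih =>
    rcases ih with ⟨i, hi⟩ | h
    · exact Or.inl ⟨σ.symm i, by simpa using hi⟩
    · exact Or.inr h

theorem exists_out_eq_edgeMap_out {S T : Tree} {f : S ⟶ T} (hf : Function.Injective (edgeMap f))
    (v : S.Vert) : ∃ w, T.out w = edgeMap f (S.out v) := by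
  rcases (gen_map f (Gen.vertex v)).exists_input_or_out with ⟨i, hi⟩ | h
  · exact absurd (hf hi ▸ i.2) (out_notMem_ins v)
  · exact h

/-- The map on vertices underlying a morphism which is injective on edges. It sends a vertex to the
lowest vertex of the subtree of `T` which is its image. -/
noncomputable def vertMap {S T : Tree} (f : S ⟶ T) (hf : Function.Injective (edgeMap f))
    (v : S.Vert) : T.Vert := (exists_out_eq_edgeMap_out hf v).choose

section

variable {R S T : Tree} (f : S ⟶ T) (hf : Function.Injective (edgeMap f))

theorem out_vertMap (v : S.Vert) : T.out (vertMap f hf v) = edgeMap f (S.out v) :=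
  (exists_out_eq_edgeMap_out hf v).choose_spec

theorem vertMap_injective : Function.Injective (vertMap f hf) := fun u v h =>
  S.out_inj (hf (by rw [← out_vertMap f hf, ← out_vertMap f hf, h]))

theorem vertMap_comp (g : R ⟶ S) (hg : Function.Injective (edgeMap g))
    (hgf : Function.Injective (edgeMap (g ≫ f))) (v : R.Vert) :
    vertMap (g ≫ f) hgf v = vertMap f hf (vertMap g hg v) := T.out_inj <| by
  rw [out_vertMap, out_vertMap, out_vertMap, edgeMap_comp]

theorem range_edgeMap_out :
    Set.range (fun v => edgeMap f (S.out v)) = T.out '' Set.range (vertMap f hf) := by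
  rw [← Set.range_comp]
  exact congrArg Set.range (funext fun v => (out_vertMap f hf v).symm)

end

section

variable {S T : Tree} (τ : S ≅ T)

theorem edgeMap_inv_hom (a : T.Edge) : edgeMap τ.hom (edgeMap τ.inv a) = a := by
  rw [← edgeMap_comp, τ.inv_hom_id, edgeMap_id]

theorem edgeMap_iso_injective : Function.Injective (edgeMap τ.hom) :=
  Function.LeftInverse.injective (edgeMap_inv_hom τ.symm)

theorem edgeMap_iso_surjective : Function.Surjective (edgeMap τ.hom) :=
  fun a => ⟨_, edgeMap_inv_hom τ a⟩

theorem vertMap_iso_surjective :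
    Function.Surjective (vertMap τ.hom (edgeMap_iso_injective τ)) := by
  intro w
  refine ⟨vertMap τ.inv (edgeMap_iso_injective τ.symm) w, T.out_inj ?_⟩
  rw [out_vertMap, out_vertMap, edgeMap_inv_hom]

theorem edgeMap_iso_mem_ins_iff (v : S.Vert) (a : S.Edge) :
    edgeMap τ.hom a ∈ T.ins (vertMap τ.hom (edgeMap_iso_injective τ) v) ↔ a ∈ S.ins v := by
  have hi := edgeMap_iso_injective τ
  rw [mem_ins_iff_covers, mem_ins_iff_covers, out_vertMap, below_edgeMap_iff hi, hi.ne_iff]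
  refine and_congr_right fun _ => and_congr_right fun _ => ?_
  rw [← (edgeMap_iso_surjective τ).forall.symm]
  simp only [below_edgeMap_iff hi, hi.eq_iff]

theorem edgeMap_iso_root : edgeMap τ.hom S.root = T.root := by
  refine below_antisymm ?_ (root_below _)
  rw [← edgeMap_inv_hom τ T.root]
  exact edgeMap_below _ (root_below _)

include τ in
theorem size_eq_of_iso : S.size = T.size :=
  Nat.card_eq_of_bijective _ ⟨vertMap_injective _ (edgeMap_iso_injective τ),
    vertMap_iso_surjective τ⟩

end

end Tree

namespace Planar

open Dendroidal.Tree

/-! ### Labels and signs under embeddings -/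

section

variable {S T : Tree} {f : S ⟶ T} (hf : Function.Injective (edgeMap f)) (p p' : Planar T)

theorem left_pullback_iff {a b : S.Edge} :
    (pullback f p).Left a b ↔ p.Left (edgeMap f a) (edgeMap f b) := by
  refine ⟨left_pullback f p, fun h => ?_⟩
  rcases (pullback f p).left_total (fun h' => h.not_below.1 (edgeMap_below f h'))
    (fun h' => h.not_below.2 (edgeMap_below f h')) with hab | hba
  · exact hab
  · exact absurd (left_pullback f p hba) h.asymm

theorem before_pullback_iff {u w : S.Vert} :
    (pullback f p).Before u w ↔ p.Before (vertMap f hf u) (vertMap f hf w) := by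
  rw [Before, Before, out_vertMap, out_vertMap, left_pullback_iff, below_edgeMap_iff hf,
    (vertMap_injective f hf).ne_iff]

theorem not_before_iff {u w : T.Vert} (h : u ≠ w) : ¬ p.Before u w ↔ p.Before w u :=
  ⟨(p.before_total h).resolve_left, fun hwu huw => Before.irrefl (hwu.trans huw)⟩

open Classical in
theorem label_eq_sum [Fintype T.Vert] (w : T.Vert) :
    p.label w = ∑ u, if p.Before u w then 1 else 0 := by
  rw [label, Nat.card_eq_fintype_card, Fintype.card_subtype, Finset.card_filter]

theorem label_lt_label_iff {u w : T.Vert} : p.label u < p.label w ↔ p.Before u w := by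
  refine ⟨fun h => ?_, label_lt_label⟩
  rcases eq_or_ne u w with rfl | hne
  · exact absurd h (lt_irrefl _)
  · by_contra hn
    exact absurd (label_lt_label ((p.not_before_iff hne).1 hn)) h.asymm

open Classical in
theorem sgn_eq_prod [Fintype T.Vert] : sgn p' p = ∏ w, ∏ u,
    if p'.Before u w then (if p.Before u w then 1 else -1) else 1 := by
  rw [sgn, Equiv.Perm.sign_eq_prod_prod_Iio, ← p'.labelEquiv.prod_comp]
  refine Finset.prod_congr rfl fun w _ => ?_
  rw [← Finset.prod_filter]
  have lt_iff (q : Planar T) (u : T.Vert) : q.labelEquiv u < q.labelEquiv w ↔ q.Before u w :=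
    q.label_lt_label_iff
  refine (Finset.prod_bij (fun u _ => p'.labelEquiv u) ?_ ?_ ?_ ?_).symm
  · exact fun u hu => Finset.mem_Iio.2 ((lt_iff p' u).2 (Finset.mem_filter.1 hu).2)
  · exact fun u _ v _ h => p'.labelEquiv.injective h
  · intro i hi
    refine ⟨p'.labelEquiv.symm i, Finset.mem_filter.2 ⟨Finset.mem_univ _, ?_⟩, by simp⟩
    rw [← lt_iff, Equiv.apply_symm_apply]
    exact Finset.mem_Iio.1 hi
  · intro u _
    simp only [Equiv.trans_apply, Equiv.symm_apply_apply, lt_iff]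

theorem sgn_self : sgn p p = 1 := by
  rw [sgn, Equiv.symm_trans_self]
  exact Equiv.Perm.sign_refl

theorem label_eq_zero {v : T.Vert} (hv : T.out v = T.root) : p.label v = 0 := by
  classical
  have := Fintype.ofFinite T.Vert
  rw [label_eq_sum]
  refine Finset.sum_eq_zero fun u _ => if_neg ?_
  rintro (⟨hne, hle⟩ | hl)
  · exact hne (T.out_inj ((below_antisymm hle (hv ▸ root_below _))))
  · exact hl.not_below.2 (hv ▸ root_below _)

theorem label_pullback_iso (τ : S ≅ T) (u : S.Vert) :
    (pullback τ.hom p).label u = p.label (vertMap τ.hom (edgeMap_iso_injective τ) u) := by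
  classical
  have := Fintype.ofFinite T.Vert
  have := Fintype.ofFinite S.Vert
  have hb : Function.Bijective (vertMap τ.hom (edgeMap_iso_injective τ)) :=
    ⟨vertMap_injective _ _, vertMap_iso_surjective τ⟩
  rw [label_eq_sum, label_eq_sum, ← hb.sum_comp]
  simp only [before_pullback_iff (edgeMap_iso_injective τ)]

end

section

variable {S T : Tree} {f : S ⟶ T} (hf : Function.Injective (edgeMap f)) (p p' : Planar T)
  {r : T.Vert} (hr : Set.range (vertMap f hf) = {r}ᶜ)

include hr

theorem vertMap_ne (u : S.Vert) : vertMap f hf u ≠ r := by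
  have h : vertMap f hf u ∈ ({r}ᶜ : Set T.Vert) := hr ▸ ⟨u, rfl⟩
  exact h

theorem prod_vert_eq {M : Type*} [CommMonoid M] [Fintype S.Vert] [Fintype T.Vert]
    (F : T.Vert → M) : ∏ w, F w = F r * ∏ u, F (vertMap f hf u) := by
  classical
  have himage : ({r}ᶜ : Finset T.Vert) = Finset.univ.image (vertMap f hf) := by
    rw [← Finset.coe_inj]
    simp [hr]
  rw [Fintype.prod_eq_mul_prod_compl r, himage,
    Finset.prod_image (vertMap_injective f hf).injOn]

theorem sum_vert_eq [Fintype S.Vert] [Fintype T.Vert] (F : T.Vert → ℕ) :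
    ∑ w, F w = F r + ∑ u, F (vertMap f hf u) :=
  prod_vert_eq (M := Multiplicative ℕ) hf hr F

open Classical in
theorem label_pullback_add_ite (u : S.Vert) :
    (pullback f p).label u + (if p.Before r (vertMap f hf u) then 1 else 0) =
      p.label (vertMap f hf u) := by
  have := Fintype.ofFinite T.Vert
  have := Fintype.ofFinite S.Vert
  rw [label_eq_sum, label_eq_sum, sum_vert_eq hf hr, add_comm]
  simp only [before_pullback_iff hf]

open Classical in
theorem neg_one_pow_label_eq_prod [Fintype S.Vert] :
    (-1 : ℤˣ) ^ p.label r = ∏ u, if p.Before (vertMap f hf u) r then -1 else 1 := by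
  have := Fintype.ofFinite T.Vert
  rw [label_eq_sum, sum_vert_eq hf hr, if_neg Before.irrefl, zero_add,
    ← Finset.prod_pow_eq_pow_sum]
  refine Finset.prod_congr rfl fun u _ => ?_
  split_ifs <;> simp

theorem sgn_eq_neg_one_pow_mul_sgn_pullback : sgn p' p =
    (-1) ^ (p'.label r + p.label r) * sgn (pullback f p') (pullback f p) := by
  classical
  have := Fintype.ofFinite T.Vert
  have := Fintype.ofFinite S.Vert
  simp only [sgn_eq_prod, before_pullback_iff hf, prod_vert_eq hf hr, Before.irrefl, if_false,
    one_mul]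
  rw [Finset.prod_mul_distrib, ← mul_assoc, pow_add, neg_one_pow_label_eq_prod hf p' hr,
    neg_one_pow_label_eq_prod hf p hr]
  congr 1
  rw [← Finset.prod_mul_distrib, ← Finset.prod_mul_distrib]
  refine Finset.prod_congr rfl fun u _ => ?_
  have hp := p.not_before_iff (vertMap_ne hf hr u)
  have hp' := p'.not_before_iff (vertMap_ne hf hr u)
  by_cases h : p.Before (vertMap f hf u) r <;> by_cases h' : p'.Before (vertMap f hf u) r <;>
    simp [h, h', ← hp, ← hp']

end

end Planar

namespace Tree

/-! ### Leaving out vertices -/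

/-- The way in which an elementary face leaves out a vertex `w`: it contracts the output of `w`, it
chops off `w` with all inputs, or it chops off `w` with the output and all inputs but `e`. -/
inductive FaceKind (E : Type)
  | inner
  | top
  | bottom (e : E)

namespace FaceKind

variable {E F : Type}

/-- The kind of face transported along a map of edges. -/
def map (φ : E → F) : FaceKind E → FaceKind F
  | inner => inner
  | top => top
  | bottom e => bottom (φ e)

theorem map_injective {φ : E → F} (hφ : Function.Injective φ) : Function.Injective (map φ) := by
  intro k l h
  cases k <;> cases l <;> simp_all [map, hφ.eq_iff]

/-- The sign of an elementary face up to the sign `(-1) ^ k` given by the label `k` of the vertex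
which it leaves out. -/
def sgn : FaceKind E → ℤ
  | top => -1
  | _ => 1

theorem sgn_map (φ : E → F) (k : FaceKind E) : (k.map φ).sgn = k.sgn := by
  cases k <;> rfl

end FaceKind

/-- What is left of a tree `T` when vertices are left out, in terms of the edges and vertices of
`T`. Each vertex keeps its output, but its inputs may change. Nothing makes an outline a tree; those
which come from trees are singled out by `Outline.IsModel`. -/
structure Outline (T : Tree) where
  edges : Set T.Edge
  verts : Set T.Vert
  root : T.Edge
  ins : T.Vert → Set T.Edge

/-- The outline of the whole tree. -/
def outline (T : Tree) : T.Outline := ⟨Set.univ, Set.univ, T.root, T.ins⟩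

namespace Outline

section

variable {T : Tree} (A : T.Outline)

/-- An edge of an outline is a leaf if it is not the output of one of its vertices. -/
def IsLeaf (a : T.Edge) : Prop := ∀ u ∈ A.verts, T.out u ≠ a

/-- The condition on an outline for having an elementary face of kind `k` which leaves out `w`. -/
def Admits (w : T.Vert) : FaceKind T.Edge → Prop
  | .inner => T.out w ≠ A.root
  | .top => ∀ a ∈ A.ins w, A.IsLeaf a
  | .bottom e => T.out w = A.root ∧ e ∈ A.ins w ∧ ∀ a ∈ A.ins w, a ≠ e → A.IsLeaf a

/-- The edges which disappear when `w` is left out by an elementary face of kind `k`. -/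
def removedEdges (w : T.Vert) : FaceKind T.Edge → Set T.Edge
  | .inner => {T.out w}
  | .top => A.ins w
  | .bottom e => insert (T.out w) (A.ins w \ {e})

/-- The outline of the elementary face of kind `k` which leaves out `w`. -/
def remove (w : T.Vert) (k : FaceKind T.Edge) : T.Outline where
  edges := A.edges \ A.removedEdges w k
  verts := A.verts \ {w}
  root := match k with
    | .bottom e => e
    | _ => A.root
  ins x := match k with
    | .inner => {a | a ≠ T.out w ∧ (a ∈ A.ins x ∨ T.out w ∈ A.ins x ∧ a ∈ A.ins w)}
    | _ => A.ins x

/-- `f` embeds `S` into `T` as the tree with outline `A`. -/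
structure IsModel {S : Tree} (f : S ⟶ T) : Prop where
  injective : Function.Injective (edgeMap f)
  range_edgeMap : Set.range (edgeMap f) = A.edges
  range_vertMap : Set.range (vertMap f injective) = A.verts
  map_root : edgeMap f S.root = A.root
  image_ins (u : S.Vert) : edgeMap f '' S.ins u = A.ins (vertMap f injective u)

end

namespace IsModel

variable {R S T : Tree} {A : T.Outline} {f : S ⟶ T} (h : A.IsModel f)

include h

theorem isLeaf_iff {a : S.Edge} : A.IsLeaf (edgeMap f a) ↔ S.outline.IsLeaf a := by
  simp only [IsLeaf, ← h.range_vertMap, Set.forall_mem_range, out_vertMap, h.injective.ne_iff,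
    outline, Set.mem_univ, true_imp_iff]

theorem admits_iff {u : S.Vert} {k : FaceKind S.Edge} :
    A.Admits (vertMap f h.injective u) (k.map (edgeMap f)) ↔ S.outline.Admits u k := by
  cases k <;> simp only [Admits, FaceKind.map, out_vertMap, ← h.map_root, ← h.image_ins,
    h.injective.eq_iff, h.injective.ne_iff, Set.forall_mem_image, h.isLeaf_iff,
    h.injective.mem_set_image, outline]

theorem image_removedEdges (u : S.Vert) (k : FaceKind S.Edge) :
    edgeMap f '' S.outline.removedEdges u k =
      A.removedEdges (vertMap f h.injective u) (k.map (edgeMap f)) := by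
  cases k <;> simp only [removedEdges, FaceKind.map, out_vertMap, ← h.image_ins, outline,
    Set.image_singleton, Set.image_insert_eq, Set.image_sdiff h.injective]

theorem comp {u : S.Vert} {k : FaceKind S.Edge} {g : R ⟶ S}
    (hg : (S.outline.remove u k).IsModel g) :
    (A.remove (vertMap f h.injective u) (k.map (edgeMap f))).IsModel (g ≫ f) := by
  have hgf : Function.Injective (edgeMap (g ≫ f)) := h.injective.comp hg.injective
  have hvert (v : R.Vert) := vertMap_comp f h.injective g hg.injective hgf v
  refine ⟨hgf, ?_, ?_, ?_, fun v => ?_⟩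
  · change Set.range (edgeMap f ∘ edgeMap g) = A.edges \ _
    rw [Set.range_comp, hg.range_edgeMap, ← h.image_removedEdges, ← h.range_edgeMap,
      ← Set.image_univ, ← Set.image_sdiff h.injective]
    rfl
  · change Set.range (vertMap (g ≫ f) hgf) = A.verts \ _
    rw [funext hvert, Set.range_comp', hg.range_vertMap, ← h.range_vertMap, ← Set.image_univ,
      ← Set.image_singleton, ← Set.image_sdiff (vertMap_injective f h.injective)]
    rfl
  · rw [edgeMap_comp, hg.map_root]
    cases k
    case bottom => rfl
    all_goals exact h.map_root
  · change (edgeMap f ∘ edgeMap g) '' R.ins v = _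
    rw [Set.image_comp, hg.image_ins, hvert]
    cases k
    case inner =>
      ext b
      simp only [remove, FaceKind.map, ← h.image_ins, out_vertMap, h.injective.mem_set_image]
      constructor
      · rintro ⟨a, ⟨hne, ha⟩, rfl⟩
        exact ⟨h.injective.ne hne,
          ha.imp (Set.mem_image_of_mem _) (And.imp_right (Set.mem_image_of_mem _))⟩
      · rintro ⟨hne, ⟨a, ha, rfl⟩ | ⟨hu, a, ha, rfl⟩⟩
        · exact ⟨a, ⟨ne_of_apply_ne _ hne, Or.inl ha⟩, rfl⟩
        · exact ⟨a, ⟨ne_of_apply_ne _ hne, Or.inr ⟨hu, ha⟩⟩, rfl⟩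
    all_goals exact h.image_ins _

end IsModel

theorem isModel_iso {S T : Tree} (τ : S ≅ T) : T.outline.IsModel τ.hom where
  injective := edgeMap_iso_injective τ
  range_edgeMap := (edgeMap_iso_surjective τ).range_eq
  range_vertMap := (vertMap_iso_surjective τ).range_eq
  map_root := edgeMap_iso_root τ
  image_ins u := by
    ext a
    obtain ⟨b, rfl⟩ := edgeMap_iso_surjective τ a
    rw [(edgeMap_iso_injective τ).mem_set_image]
    exact (edgeMap_iso_mem_ins_iff τ u b).symm

end Outline

namespace Face

variable {T : Tree}

/-- The vertex which an elementary face leaves out. For an inner face this is the vertex above the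
contracted edge, as an inner face has the lower vertex represent the composition of the two. -/
def vertex : T.Face → T.Vert
  | .inner _ w _ => w
  | .top w _ => w
  | .bottom v _ _ _ _ => v

/-- The way in which an elementary face leaves out its vertex. -/
def kind : T.Face → FaceKind T.Edge
  | .inner _ _ _ => .inner
  | .top _ _ => .top
  | .bottom _ e _ _ _ => .bottom e

/-- The outline of the source of an elementary face map. -/
def outline (f : T.Face) : T.Outline := T.outline.remove f.vertex f.kind

theorem ext_vertex_kind {f g : T.Face} (hv : f.vertex = g.vertex) (hk : f.kind = g.kind) :
    f = g := by
  cases f <;> cases g <;> simp only [kind, reduceCtorEq, FaceKind.bottom.injEq] at hk <;>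
    simp only [vertex] at hv <;> subst hv
  case inner.inner v w h v' h' =>
    obtain rfl := T.ins_unique h h'
    rfl
  case top.top => rfl
  case bottom.bottom =>
    subst hk
    rfl

theorem admits (f : T.Face) : T.outline.Admits f.vertex f.kind := by
  cases f with
  | inner v w h => exact (T.exists_ins_iff _).1 ⟨v, h⟩
  | top w h => exact fun a ha u _ => h a ha u
  | bottom v e hv he h => exact ⟨hv, he, fun a ha hae u _ => h a ha hae u⟩

theorem exists_of_admits {w : T.Vert} {k : FaceKind T.Edge} (h : T.outline.Admits w k) :
    ∃ f : T.Face, f.vertex = w ∧ f.kind = k := by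
  cases k with
  | inner =>
    obtain ⟨v, hv⟩ := (T.exists_ins_iff _).2 h
    exact ⟨.inner v w hv, rfl, rfl⟩
  | top => exact ⟨.top w fun a ha u => h a ha u trivial, rfl, rfl⟩
  | bottom e =>
    exact ⟨.bottom w e h.1 h.2.1 fun a ha hae u => h.2.2 a ha hae u trivial, rfl, rfl⟩

theorem sgn_eq (p : Planar T) (f : T.Face) :
    f.sgn p = f.kind.sgn * (-1) ^ p.label f.vertex := by
  cases f with
  | inner v w h => exact (one_mul _).symm
  | top w h => exact pow_succ' _ _
  | bottom v e hv he h => simp [sgn, kind, FaceKind.sgn, vertex, p.label_eq_zero hv]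

theorem incl_injective (f : T.Face) : Function.Injective (edgeMap f.incl) := by
  cases f <;> exact Subtype.val_injective

/-- The vertices of an elementary face as vertices of the tree. -/
noncomputable def vert (f : T.Face) : f.tree.Vert → T.Vert := vertMap f.incl f.incl_injective

theorem range_vert (f : T.Face) : Set.range f.vert = {f.vertex}ᶜ := by
  ext x
  cases f
  all_goals
    constructor
    · rintro ⟨u, rfl⟩ h
      exact u.2 ((T.out_inj (out_vertMap _ _ u)).symm.trans h)
    · exact fun h => ⟨⟨x, h⟩, T.out_inj (out_vertMap _ _ _)⟩

theorem range_incl (f : T.Face) : Set.range (edgeMap f.incl) = f.outline.edges := by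
  cases f with
  | inner v w h => exact Subtype.range_coe.trans (Set.compl_eq_univ_sdiff {T.out w})
  | top w h => exact Subtype.range_coe.trans (Set.compl_eq_univ_sdiff (T.ins w))
  | bottom v e hv he h =>
    refine Subtype.range_coe.trans (Set.ext fun a => ?_)
    change a ≠ T.root ∧ (a ∈ T.ins v → a = e) ↔ True ∧ ¬(a = T.out v ∨ a ∈ T.ins v ∧ a ≠ e)
    rw [hv]
    tauto

theorem image_ins (f : T.Face) (u : f.tree.Vert) :
    edgeMap f.incl '' f.tree.ins u = f.outline.ins (f.vert u) := by
  have hout : T.out (f.vert u) = edgeMap f.incl (f.tree.out u) := out_vertMap _ _ u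
  generalize f.vert u = x at hout
  cases f <;> obtain ⟨u, hu⟩ := u <;> obtain rfl : x = u := T.out_inj hout <;>
    ext a <;> constructor <;> intro ha
  case inner.mp v w h =>
    obtain ⟨⟨a, ha⟩, hau | ⟨rfl, haw⟩, rfl⟩ := ha
    · exact ⟨ha, Or.inl hau⟩
    · exact ⟨ha, Or.inr ⟨h, haw⟩⟩
  case inner.mpr v w h =>
    exact ⟨⟨a, ha.1⟩, ha.2.imp_right fun ⟨hwu, haw⟩ => ⟨T.ins_unique hwu h, haw⟩, rfl⟩
  case top.mpr w h => exact ⟨⟨a, fun haw => hu (T.ins_unique ha haw)⟩, ha, rfl⟩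
  case bottom.mpr v e hv he h =>
    exact ⟨⟨a, (T.exists_ins_iff _).1 ⟨x, ha⟩, fun hav => absurd (T.ins_unique ha hav) hu⟩,
      ha, rfl⟩
  all_goals
    obtain ⟨⟨a, _⟩, hau, rfl⟩ := ha
    exact hau

theorem isModel_incl (f : T.Face) : f.outline.IsModel f.incl where
  injective := f.incl_injective
  range_edgeMap := f.range_incl
  range_vertMap := f.range_vert.trans (Set.compl_eq_univ_sdiff _)
  map_root := by cases f <;> rfl
  image_ins := f.image_ins

theorem sgn_mul_sgn_pullback (p p' : Planar T) (f : T.Face) :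
    f.sgn p * (Planar.sgn (Planar.pullback f.incl p') (Planar.pullback f.incl p) : ℤˣ) =
      (Planar.sgn p' p : ℤˣ) * f.sgn p' := by
  rw [Planar.sgn_eq_neg_one_pow_mul_sgn_pullback f.incl_injective p p' f.range_vert, sgn_eq, sgn_eq]
  have h : (-1 : ℤ) ^ p'.label f.vertex * (-1) ^ p'.label f.vertex = 1 := by
    rw [← pow_add, Even.neg_one_pow ⟨_, rfl⟩]
  push_cast
  rw [pow_add]
  linear_combination (-(f.kind.sgn * (-1) ^ p.label f.vertex *
    ((Planar.sgn (Planar.pullback f.incl p') (Planar.pullback f.incl p) : ℤˣ) : ℤ))) * h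

section

variable {S : Tree} (τ : S ≅ T)

/-- The elementary face of `T` corresponding to an elementary face of an isomorphic tree. -/
noncomputable def mapIso (f : S.Face) : T.Face :=
  (exists_of_admits ((Outline.isModel_iso τ).admits_iff.2 f.admits)).choose

theorem vertex_mapIso (f : S.Face) :
    (f.mapIso τ).vertex = vertMap τ.hom (edgeMap_iso_injective τ) f.vertex :=
  (exists_of_admits ((Outline.isModel_iso τ).admits_iff.2 f.admits)).choose_spec.1

theorem kind_mapIso (f : S.Face) : (f.mapIso τ).kind = f.kind.map (edgeMap τ.hom) :=
  (exists_of_admits ((Outline.isModel_iso τ).admits_iff.2 f.admits)).choose_spec.2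

theorem mapIso_injective : Function.Injective (mapIso τ) := by
  intro f g h
  refine ext_vertex_kind ?_ ?_
  · apply vertMap_injective τ.hom (edgeMap_iso_injective τ)
    rw [← vertex_mapIso, ← vertex_mapIso, h]
  · apply FaceKind.map_injective (edgeMap_iso_injective τ)
    rw [← kind_mapIso, ← kind_mapIso, h]

theorem mapIso_bijective : Function.Bijective (mapIso τ) :=
  (mapIso_injective τ).bijective_of_nat_card_le
    (Nat.card_le_card_of_injective _ (mapIso_injective τ.symm))

theorem sgn_mapIso (p : Planar T) (f : S.Face) :
    (f.mapIso τ).sgn p = f.sgn (Planar.pullback τ.hom p) := by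
  rw [sgn_eq, sgn_eq, vertex_mapIso, kind_mapIso, FaceKind.sgn_map, Planar.label_pullback_iso]

theorem isModel_incl_comp_iso (f : S.Face) :
    (f.mapIso τ).outline.IsModel (f.incl ≫ τ.hom) := by
  rw [outline, vertex_mapIso, kind_mapIso]
  exact (Outline.isModel_iso τ).comp f.isModel_incl

end

end Face

end Tree

open Dendroidal.Tree

variable {X : DendroidalSet.{u}}

/-! ### The differential -/

theorem DendroidalSet.restrict_id {T : Tree} (x : X.obj (Opposite.op T)) :
    DendroidalSet.restrict (𝟙 T) x = x := by
  simp [DendroidalSet.restrict]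

theorem DendroidalSet.restrict_comp {R S T : Tree} (f : R ⟶ S) (g : S ⟶ T)
    (x : X.obj (Opposite.op T)) :
    DendroidalSet.restrict (f ≫ g) x = DendroidalSet.restrict f (DendroidalSet.restrict g x) := by
  simp [DendroidalSet.restrict]

theorem cls_eq_sgn_smul_of_iso {n : ℕ} {T T' : Tree} (hT : T.size = n) (hT' : T'.size = n)
    (p : Planar T) (p' : Planar T') (τ : T' ≅ T) (x : X.obj (Opposite.op T)) :
    PlanarDendrex.cls ⟨T, hT, p, x⟩ = ((Planar.sgn p' (Planar.pullback τ.hom p) : ℤˣ) : ℤ) •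
      PlanarDendrex.cls ⟨T', hT', p', DendroidalSet.restrict τ.hom x⟩ :=
  QuotientAddGroup.eq_iff_sub_mem.2
    (AddSubgroup.subset_closure ⟨T, T', hT, hT', p, p', τ, x, rfl⟩)

theorem cls_eq_sgn_smul {n : ℕ} {T : Tree} (hT : T.size = n) (p p' : Planar T)
    (x : X.obj (Opposite.op T)) :
    PlanarDendrex.cls ⟨T, hT, p, x⟩ =
      ((Planar.sgn p' p : ℤˣ) : ℤ) • PlanarDendrex.cls ⟨T, hT, p', x⟩ := by
  have h := cls_eq_sgn_smul_of_iso hT hT p p' (Iso.refl T) x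
  rwa [Iso.refl_hom, Planar.pullback_id, DendroidalSet.restrict_id] at h

theorem cls_eq_of_iso {n : ℕ} {T T' : Tree} (hT : T.size = n) (hT' : T'.size = n)
    (p : Planar T) (τ : T' ≅ T) (x : X.obj (Opposite.op T)) :
    PlanarDendrex.cls ⟨T, hT, p, x⟩ =
      PlanarDendrex.cls ⟨T', hT', Planar.pullback τ.hom p, DendroidalSet.restrict τ.hom x⟩ := by
  rw [cls_eq_sgn_smul_of_iso hT hT' p (Planar.pullback τ.hom p) τ x, Planar.sgn_self,
    Units.val_one, one_smul]

theorem cls_eq_of_isModel {n : ℕ} {S S' T : Tree} (hS : S.size = n) (hS' : S'.size = n)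
    {f : S ⟶ T} {g : S' ⟶ T} {A B : T.Outline} (hf : A.IsModel f) (hg : B.IsModel g)
    (hedges : A.edges = B.edges) (hverts : A.verts = B.verts) (p : Planar T)
    (x : X.obj (Opposite.op T)) :
    PlanarDendrex.cls ⟨S, hS, Planar.pullback f p, DendroidalSet.restrict f x⟩ =
      PlanarDendrex.cls ⟨S', hS', Planar.pullback g p, DendroidalSet.restrict g x⟩ := by
  obtain ⟨α, hα⟩ := exists_iso_of_range_eq hf.injective hg.injective
    (fun _ _ => below_edgeMap_iff hf.injective) (fun _ _ => below_edgeMap_iff hg.injective)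
    (by rw [hf.range_edgeMap, hg.range_edgeMap, hedges])
    (by rw [range_edgeMap_out f hf.injective, range_edgeMap_out g hg.injective, hf.range_vertMap,
      hg.range_vertMap, hverts])
  obtain rfl : α.hom ≫ g = f := hom_ext hα
  rw [cls_eq_of_iso hS' hS _ α, Planar.pullback_comp, DendroidalSet.restrict_comp]

/-- The signed sum of the elementary faces of a planar dendrex. -/
noncomputable def faceSum {n : ℕ} (g : PlanarDendrex X (n + 1)) : Chun X n :=
  ∑ f : g.tree.Face, f.sgn g.planar • (g.face f).cls

theorem faceSum_eq_sgn_smul {n : ℕ} {T : Tree} (hT : T.size = n + 1) (p p' : Planar T)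
    (x : X.obj (Opposite.op T)) :
    faceSum ⟨T, hT, p, x⟩ = ((Planar.sgn p' p : ℤˣ) : ℤ) • faceSum ⟨T, hT, p', x⟩ := by
  rw [faceSum, faceSum, Finset.smul_sum]
  refine Finset.sum_congr rfl fun f _ => ?_
  have h := cls_eq_sgn_smul (f.size_tree hT) (Planar.pullback f.incl p) (Planar.pullback f.incl p')
    (DendroidalSet.restrict f.incl x)
  rw [PlanarDendrex.face, h, smul_smul, f.sgn_mul_sgn_pullback p p', mul_smul]
  rfl

theorem faceSum_eq_of_iso {n : ℕ} {T T' : Tree} (hT : T.size = n + 1) (hT' : T'.size = n + 1)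
    (p : Planar T) (τ : T' ≅ T) (x : X.obj (Opposite.op T)) :
    faceSum ⟨T, hT, p, x⟩ =
      faceSum ⟨T', hT', Planar.pullback τ.hom p, DendroidalSet.restrict τ.hom x⟩ := by
  refine ((Face.mapIso_bijective τ).sum_comp _).symm.trans (Finset.sum_congr rfl fun f _ => ?_)
  have h := cls_eq_of_isModel ((f.mapIso τ).size_tree hT) (f.size_tree hT')
    (f.mapIso τ).isModel_incl (f.isModel_incl_comp_iso τ) rfl rfl p x
  rw [PlanarDendrex.face, h, Face.sgn_mapIso, Planar.pullback_comp, DendroidalSet.restrict_comp]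
  rfl

/-- The differential of the complex, given on generators by the signed sum of the faces. -/
noncomputable def differential (X : DendroidalSet.{u}) (n : ℕ) : Chun X (n + 1) →+ Chun X n :=
  QuotientAddGroup.lift (A X (n + 1)) (FreeAbelianGroup.lift faceSum) <| by
    rw [A, AddSubgroup.closure_le]
    rintro _ ⟨T, T', hT, hT', p, p', τ, x, rfl⟩
    rw [SetLike.mem_coe, AddMonoidHom.mem_ker, map_sub, map_zsmul, FreeAbelianGroup.lift_apply_of,
      FreeAbelianGroup.lift_apply_of, sub_eq_zero, faceSum_eq_of_iso hT hT' p τ x,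
      faceSum_eq_sgn_smul hT' (Planar.pullback τ.hom p) p']

theorem isFaceDifferential_differential (X : DendroidalSet.{u}) :
    IsFaceDifferential X (differential X) := fun _ g => FreeAbelianGroup.lift_apply_of faceSum g

theorem chun_hom_ext {n : ℕ} {B : Type*} [AddCommGroup B] {φ ψ : Chun X n →+ B}
    (h : ∀ g : PlanarDendrex X n, φ g.cls = ψ g.cls) : φ = ψ :=
  QuotientAddGroup.addMonoidHom_ext _ (FreeAbelianGroup.lift_ext _ _ h)

namespace Tree

/-! ### Pairs of successive elementary faces -/

/-- The vertices left out by an elementary face of an elementary face of `T`, in their order, with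
the ways in which they are left out. -/
@[ext] structure FacePair (T : Tree) where
  fst : T.Vert
  fstKind : FaceKind T.Edge
  snd : T.Vert
  sndKind : FaceKind T.Edge

namespace FacePair

variable {T : Tree}

/-- The outline left by the first face of a pair. -/
def fstOutline (c : T.FacePair) : T.Outline := T.outline.remove c.fst c.fstKind

/-- The outline left by both faces of a pair. -/
def outline (c : T.FacePair) : T.Outline := c.fstOutline.remove c.snd c.sndKind

/-- The condition for a pair to come from an elementary face of an elementary face. -/
structure IsValid (c : T.FacePair) : Prop where
  ne : c.snd ≠ c.fst
  fst : T.outline.Admits c.fst c.fstKind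
  snd : c.fstOutline.Admits c.snd c.sndKind

/-- The same two vertices left out in the opposite order in the same ways. -/
def swap (c : T.FacePair) : T.FacePair := ⟨c.snd, c.sndKind, c.fst, c.fstKind⟩

/-- The first vertex is an input of the second one and ends up in a part of the tree which is
chopped off with the second vertex. Hence it could be chopped off or contracted just as well. -/
def IsPruning (c : T.FacePair) : Prop :=
  T.out c.fst ∈ T.ins c.snd ∧ (∀ e, c.fstKind ≠ .bottom e) ∧ c.sndKind ≠ .inner ∧
    ∀ e, c.sndKind = .bottom e → e ≠ T.out c.fst ∧ e ∉ T.ins c.fst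

/-- The move on prunings which exchanges contracting and chopping off the first vertex. -/
def toggle (c : T.FacePair) : T.FacePair where
  __ := c
  fstKind := match c.fstKind with
    | .inner => .top
    | .top => .inner
    | .bottom e => .bottom e

/-- The root vertex and the vertex above it are chopped off at the bottom, either one by one or as
one vertex after contracting the edge between them. -/
def IsFelling (c : T.FacePair) : Prop :=
  match c.fstKind, c.sndKind with
  | .inner, .bottom e => e ∈ T.ins c.fst
  | .bottom _, .bottom _ => True
  | _, _ => False

/-- The move on fellings which exchanges the two ways of chopping off the two vertices. -/
def refell (c : T.FacePair) : T.FacePair where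
  fst := c.snd
  fstKind := match c.fstKind with
    | .bottom _ => .inner
    | _ => .bottom (T.out c.fst)
  snd := c.fst
  sndKind := c.sndKind

theorem isPruning_toggle {c : T.FacePair} (h : c.IsPruning) : c.toggle.IsPruning := by
  obtain ⟨w, k, x, l⟩ := c
  cases k <;> simp_all [IsPruning, toggle]

theorem toggle_toggle (c : T.FacePair) : c.toggle.toggle = c := by
  obtain ⟨w, _ | _ | _, x, l⟩ := c <;> rfl

theorem IsPruning.isValid_toggle {c : T.FacePair} (h : c.IsPruning) (hc : c.IsValid) :
    c.toggle.IsValid := by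
  obtain ⟨w, k, x, l⟩ := c
  obtain ⟨hne, hfst, hsnd⟩ := hc
  cases k <;> cases l <;> constructor <;>
    simp only [IsPruning, toggle, fstOutline, Outline.Admits, Outline.remove, Outline.IsLeaf,
      Tree.outline] at * <;>
    grind +splitImp [T.out_inj, T.ins_unique, out_notMem_ins, root_notMem_ins]

theorem IsPruning.edges_toggle {c : T.FacePair} (h : c.IsPruning) :
    c.toggle.outline.edges = c.outline.edges := by
  obtain ⟨w, k, x, l⟩ := c
  ext a
  cases k <;> cases l <;>
    simp only [IsPruning, toggle, fstOutline, outline, Outline.remove, Tree.outline,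
      Outline.removedEdges] at * <;>
    grind +splitImp [T.out_inj, T.ins_unique, out_notMem_ins, root_notMem_ins]

theorem IsFelling.isFelling_refell {c : T.FacePair} (h : c.IsFelling) (hc : c.IsValid) :
    c.refell.IsFelling := by
  obtain ⟨w, k, x, l⟩ := c
  obtain ⟨hne, hfst, hsnd⟩ := hc
  cases k <;> cases l <;>
    simp_all [IsFelling, refell, fstOutline, Outline.Admits, Outline.remove, Tree.outline]

theorem IsFelling.not_isPruning {c : T.FacePair} (h : c.IsFelling) : ¬ c.IsPruning := by
  obtain ⟨w, k, x, l⟩ := c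
  cases k <;> cases l <;> simp_all [IsFelling, IsPruning]

theorem IsFelling.refell_refell {c : T.FacePair} (h : c.IsFelling) (hc : c.IsValid) :
    c.refell.refell = c := by
  obtain ⟨w, k, x, l⟩ := c
  obtain ⟨hne, hfst, hsnd⟩ := hc
  cases k <;> cases l <;>
    simp_all [IsFelling, refell, fstOutline, Outline.Admits, Outline.remove, Tree.outline]

theorem IsFelling.isValid_refell {c : T.FacePair} (h : c.IsFelling) (hc : c.IsValid) :
    c.refell.IsValid := by
  obtain ⟨w, k, x, l⟩ := c
  obtain ⟨hne, hfst, hsnd⟩ := hc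
  cases k <;> cases l <;> constructor <;>
    simp only [IsFelling, refell, fstOutline, Outline.Admits, Outline.remove, Outline.IsLeaf,
      Tree.outline] at * <;>
    grind +splitImp [T.out_inj, T.ins_unique, out_notMem_ins, root_notMem_ins]

theorem IsFelling.edges_refell {c : T.FacePair} (h : c.IsFelling) (hc : c.IsValid) :
    c.refell.outline.edges = c.outline.edges := by
  obtain ⟨w, k, x, l⟩ := c
  obtain ⟨hne, hfst, hsnd⟩ := hc
  ext a
  cases k <;> cases l <;>
    simp only [IsFelling, refell, fstOutline, outline, Outline.Admits, Outline.remove,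
      Outline.IsLeaf, Tree.outline, Outline.removedEdges] at * <;>
    grind +splitImp [T.out_inj, T.ins_unique, out_notMem_ins, root_notMem_ins]

theorem isValid_swap {c : T.FacePair} (hc : c.IsValid) (hp : ¬ c.IsPruning) (hf : ¬ c.IsFelling) :
    c.swap.IsValid := by
  obtain ⟨w, k, x, l⟩ := c
  obtain ⟨hne, hfst, hsnd⟩ := hc
  cases k <;> cases l <;> constructor <;>
    simp only [IsPruning, IsFelling, swap, fstOutline, Outline.Admits, Outline.remove,
      Outline.IsLeaf, Tree.outline] at * <;>
    grind +splitImp [T.out_inj, T.ins_unique, out_notMem_ins, root_notMem_ins]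

theorem IsValid.not_isPruning_swap {c : T.FacePair} (hc : c.IsValid) : ¬ c.swap.IsPruning := by
  obtain ⟨w, k, x, l⟩ := c
  obtain ⟨hne, hfst, hsnd⟩ := hc
  cases k <;> cases l <;>
    simp only [IsPruning, swap, fstOutline, Outline.Admits, Outline.remove,
      Outline.IsLeaf, Tree.outline] at * <;>
    grind +splitImp [T.out_inj, T.ins_unique, out_notMem_ins, root_notMem_ins]

theorem IsValid.not_isFelling_swap {c : T.FacePair} (hc : c.IsValid) (hf : ¬ c.IsFelling) :
    ¬ c.swap.IsFelling := by
  obtain ⟨w, k, x, l⟩ := c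
  obtain ⟨hne, hfst, hsnd⟩ := hc
  cases k <;> cases l <;>
    simp only [IsFelling, swap, fstOutline, Outline.Admits, Outline.remove,
      Outline.IsLeaf, Tree.outline] at * <;>
    grind +splitImp [T.out_inj, T.ins_unique, out_notMem_ins, root_notMem_ins]

theorem edges_swap {c : T.FacePair} (hc : c.IsValid) (hp : ¬ c.IsPruning) (hf : ¬ c.IsFelling) :
    c.swap.outline.edges = c.outline.edges := by
  obtain ⟨w, k, x, l⟩ := c
  obtain ⟨hne, hfst, hsnd⟩ := hc
  ext a
  cases k <;> cases l <;>
    simp only [IsPruning, IsFelling, swap, fstOutline, outline, Outline.Admits, Outline.remove,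
      Outline.IsLeaf, Tree.outline, Outline.removedEdges] at * <;>
    grind +splitImp [T.out_inj, T.ins_unique, out_notMem_ins, root_notMem_ins]

open Classical in
/-- The other pair of elementary faces which leaves the same subtree. -/
noncomputable def partner (c : T.FacePair) : T.FacePair :=
  if c.IsPruning then c.toggle else if c.IsFelling then c.refell else c.swap

theorem isValid_partner {c : T.FacePair} (hc : c.IsValid) : c.partner.IsValid := by
  rw [partner]
  split_ifs with hp hf
  · exact hp.isValid_toggle hc
  · exact hf.isValid_refell hc
  · exact isValid_swap hc hp hf

theorem partner_partner {c : T.FacePair} (hc : c.IsValid) : c.partner.partner = c := by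
  by_cases hp : c.IsPruning
  · rw [partner, partner, if_pos hp, if_pos (isPruning_toggle hp), toggle_toggle]
  by_cases hf : c.IsFelling
  · have hf' := hf.isFelling_refell hc
    rw [partner, partner, if_neg hp, if_pos hf, if_neg hf'.not_isPruning, if_pos hf',
      hf.refell_refell hc]
  · rw [partner, partner, if_neg hp, if_neg hf, if_neg hc.not_isPruning_swap,
      if_neg (hc.not_isFelling_swap hf)]
    rfl

theorem edges_partner {c : T.FacePair} (hc : c.IsValid) :
    c.partner.outline.edges = c.outline.edges := by
  rw [partner]
  split_ifs with hp hf
  · exact hp.edges_toggle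
  · exact hf.edges_refell hc
  · exact edges_swap hc hp hf

theorem verts_partner (c : T.FacePair) : c.partner.outline.verts = c.outline.verts := by
  rw [partner]
  split_ifs
  · rfl
  all_goals exact Set.sdiff_sdiff_comm

open Classical in
/-- The product of the signs of the two faces, in terms of the labels in the whole tree: after
leaving out the first vertex, the label of the second one drops by one if the first came before. -/
noncomputable def sgn (c : T.FacePair) (p : Planar T) : ℤ :=
  c.fstKind.sgn * c.sndKind.sgn *
    (-1) ^ (p.label c.fst + p.label c.snd + if p.Before c.fst c.snd then 1 else 0)

theorem sgn_eq_neg_of_exchange {c c' : T.FacePair} (p : Planar T) (hne : c.snd ≠ c.fst)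
    (hfst : c'.fst = c.snd) (hsnd : c'.snd = c.fst)
    (hkind : c'.fstKind.sgn * c'.sndKind.sgn = c.fstKind.sgn * c.sndKind.sgn) :
    c'.sgn p = - c.sgn p := by
  rw [sgn, sgn, hfst, hsnd, hkind, add_comm (p.label c.snd)]
  by_cases h : p.Before c.fst c.snd
  · rw [if_pos h, if_neg ((p.not_before_iff hne).2 h), pow_succ]
    ring
  · rw [if_neg h, if_pos ((p.not_before_iff hne.symm).1 h), pow_succ]
    ring

theorem IsPruning.sgn_toggle {c : T.FacePair} (h : c.IsPruning) (p : Planar T) :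
    c.toggle.sgn p = - c.sgn p := by
  have hkind : c.toggle.fstKind.sgn = - c.fstKind.sgn := by
    obtain ⟨w, k, x, l⟩ := c
    cases k with
    | bottom e => exact absurd rfl (h.2.1 e)
    | _ => rfl
  rw [sgn, sgn, hkind, neg_mul, neg_mul]
  rfl

theorem sgn_partner {c : T.FacePair} (hc : c.IsValid) (p : Planar T) :
    c.partner.sgn p = - c.sgn p := by
  rw [partner]
  split_ifs with hp hf
  · exact hp.sgn_toggle p
  · refine sgn_eq_neg_of_exchange p hc.ne rfl rfl ?_
    obtain ⟨w, k, x, l⟩ := c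
    cases k <;> cases l <;> simp_all [IsFelling, refell, FaceKind.sgn]
  · exact sgn_eq_neg_of_exchange p hc.ne rfl rfl (mul_comm _ _)

theorem sgn_ne_zero (c : T.FacePair) (p : Planar T) : c.sgn p ≠ 0 := by
  obtain ⟨w, k, x, l⟩ := c
  cases k <;> cases l <;> simp [sgn, FaceKind.sgn]

end FacePair

namespace Face

variable {T : Tree}

/-- The vertices left out by two successive elementary faces. -/
noncomputable def pair (f : T.Face) (g : f.tree.Face) : T.FacePair :=
  ⟨f.vertex, f.kind, f.vert g.vertex, g.kind.map (edgeMap f.incl)⟩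

theorem isModel_pair (f : T.Face) (g : f.tree.Face) :
    (f.pair g).outline.IsModel (g.incl ≫ f.incl) :=
  f.isModel_incl.comp g.isModel_incl

theorem vert_ne_vertex (f : T.Face) (u : f.tree.Vert) : f.vert u ≠ f.vertex :=
  f.range_vert.subset ⟨u, rfl⟩

theorem isValid_pair (f : T.Face) (g : f.tree.Face) : (f.pair g).IsValid :=
  ⟨f.vert_ne_vertex _, f.admits, f.isModel_incl.admits_iff.2 g.admits⟩

theorem exists_map_eq_of_admits (f : T.Face) {u : f.tree.Vert} {l : FaceKind T.Edge}
    (h : f.outline.Admits (f.vert u) l) :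
    ∃ k : FaceKind f.tree.Edge, k.map (edgeMap f.incl) = l := by
  cases l with
  | inner => exact ⟨.inner, rfl⟩
  | top => exact ⟨.top, rfl⟩
  | bottom e =>
    obtain ⟨a, -, rfl⟩ : e ∈ edgeMap f.incl '' f.tree.ins u := (f.image_ins u).symm ▸ h.2.1
    exact ⟨.bottom a, rfl⟩

theorem exists_pair_eq {c : T.FacePair} (hc : c.IsValid) :
    ∃ (f : T.Face) (g : f.tree.Face), f.pair g = c := by
  obtain ⟨w, k, x, l⟩ := c
  obtain ⟨hne, hfst, hsnd⟩ := hc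
  obtain ⟨f, rfl, rfl⟩ := exists_of_admits hfst
  obtain ⟨u, rfl⟩ : x ∈ Set.range f.vert := f.range_vert.symm ▸ hne
  obtain ⟨k, rfl⟩ := f.exists_map_eq_of_admits hsnd
  obtain ⟨g, rfl, rfl⟩ := exists_of_admits (f.isModel_incl.admits_iff.1 hsnd)
  exact ⟨f, g, rfl⟩

theorem pair_injective : Function.Injective fun q : Σ f : T.Face, f.tree.Face => q.1.pair q.2 := by
  rintro ⟨f, g⟩ ⟨f', g'⟩ h
  obtain ⟨hv, hk, hv', hk'⟩ := FacePair.ext_iff.1 h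
  obtain rfl : f = f' := ext_vertex_kind hv hk
  obtain rfl : g = g' := ext_vertex_kind (vertMap_injective _ f.incl_injective hv')
    (FaceKind.map_injective f.incl_injective hk')
  rfl

/-- Pairs of successive elementary faces are the same as valid pairs of vertices left out. -/
noncomputable def pairEquiv : (Σ f : T.Face, f.tree.Face) ≃ {c : T.FacePair // c.IsValid} :=
  Equiv.ofBijective (fun q => ⟨q.1.pair q.2, q.1.isValid_pair q.2⟩)
    ⟨fun _ _ h => pair_injective (congrArg Subtype.val h), fun c => by
      obtain ⟨f, g, h⟩ := exists_pair_eq c.2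
      exact ⟨⟨f, g⟩, Subtype.ext h⟩⟩

theorem sgn_mul_sgn (p : Planar T) (f : T.Face) (g : f.tree.Face) :
    f.sgn p * g.sgn (Planar.pullback f.incl p) = (f.pair g).sgn p := by
  classical
  have hlabel : (Planar.pullback f.incl p).label g.vertex +
      (if p.Before f.vertex (f.vert g.vertex) then 1 else 0) = p.label (f.vert g.vertex) :=
    Planar.label_pullback_add_ite f.incl_injective p f.range_vert g.vertex
  rw [sgn_eq, sgn_eq, FacePair.sgn, pair, FaceKind.sgn_map, ← hlabel]
  split_ifs <;> ring

end Face

end Tree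

theorem cls_face_face_eq {n : ℕ} (g : PlanarDendrex X (n + 1 + 1))
    {f f' : g.tree.Face} {h : f.tree.Face} {h' : f'.tree.Face}
    (heq : f'.pair h' = (f.pair h).partner) :
    ((g.face f').face h').cls = ((g.face f).face h).cls := by
  have hcls := cls_eq_of_isModel (h'.size_tree (f'.size_tree g.size_tree))
    (h.size_tree (f.size_tree g.size_tree)) (f'.isModel_pair h') (f.isModel_pair h)
    (by rw [heq, FacePair.edges_partner (f.isValid_pair h)]) (by rw [heq, FacePair.verts_partner])
    g.planar g.dendrex
  rwa [Planar.pullback_comp, Planar.pullback_comp, DendroidalSet.restrict_comp,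
    DendroidalSet.restrict_comp] at hcls

theorem sum_face_face_eq_zero {n : ℕ} (g : PlanarDendrex X (n + 1 + 1)) :
    ∑ q : Σ f : g.tree.Face, f.tree.Face,
      (q.1.pair q.2).sgn g.planar • ((g.face q.1).face q.2).cls = 0 := by
  classical
  let partner (q : Σ f : g.tree.Face, f.tree.Face) : Σ f : g.tree.Face, f.tree.Face :=
    Face.pairEquiv.symm ⟨_, FacePair.isValid_partner (q.1.isValid_pair q.2)⟩
  have hpair (q) : (partner q).1.pair (partner q).2 = (q.1.pair q.2).partner :=
    congrArg Subtype.val (Face.pairEquiv.apply_symm_apply _)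
  have hsgn (q) : ((partner q).1.pair (partner q).2).sgn g.planar =
      - (q.1.pair q.2).sgn g.planar := by
    rw [hpair, FacePair.sgn_partner (q.1.isValid_pair q.2)]
  refine Finset.sum_involution (fun q _ => partner q) (fun q _ => ?_) (fun q _ _ hq => ?_)
    (fun _ _ => Finset.mem_univ _) (fun q _ => ?_)
  · rw [cls_face_face_eq g (hpair q), hsgn, neg_smul, add_neg_cancel]
  · have h := hsgn q
    rw [hq] at h
    exact (q.1.pair q.2).sgn_ne_zero g.planar (self_eq_neg.1 h)
  · refine Face.pair_injective ?_
    change (partner (partner q)).1.pair (partner (partner q)).2 = _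
    rw [hpair, hpair, FacePair.partner_partner (q.1.isValid_pair q.2)]

theorem IsFaceDifferential.comp_eq_zero {d : ∀ n : ℕ, Chun X (n + 1) →+ Chun X n}
    (hd : IsFaceDifferential X d) (n : ℕ) : (d n).comp (d (n + 1)) = 0 := by
  refine chun_hom_ext fun g => ?_
  rw [AddMonoidHom.comp_apply, hd, map_sum, AddMonoidHom.zero_apply, ← sum_face_face_eq_zero g,
    Fintype.sum_sigma]
  refine Finset.sum_congr rfl fun f _ => ?_
  rw [map_zsmul, hd, Finset.smul_sum]
  refine Finset.sum_congr rfl fun h _ => ?_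
  rw [smul_smul, ← Face.sgn_mul_sgn]
  rfl

namespace Tree

/-! ### The trees `σ_e S` -/

section

variable {S T : Tree}

theorem exists_iso_hom_eq_of_bijective {f : S ⟶ T} (hf : Function.Bijective (edgeMap f))
    (hsize : S.size = T.size) : ∃ α : S ≅ T, α.hom = f := by
  have hvert : Function.Surjective (vertMap f hf.injective) :=
    ((vertMap_injective f hf.injective).bijective_of_nat_card_le hsize.ge).surjective
  obtain ⟨α, hα⟩ := exists_iso_of_range_eq hf.injective Function.injective_id
    (fun _ _ => below_edgeMap_iff hf.injective) (fun _ _ => Iff.rfl)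
    (by rw [hf.surjective.range_eq, Set.range_id])
    (by rw [range_edgeMap_out f hf.injective, hvert.range_eq, Set.image_univ]; rfl)
  exact ⟨α, hom_ext hα⟩

end

section Degen

variable {R S : Tree} {e : S.Edge}

theorem degen_out_some_of_eq {v : S.Vert} (h : S.out v = e) :
    (S.degen e).out (some v) = none := if_pos h

theorem degen_out_some_of_ne {v : S.Vert} (h : S.out v ≠ e) :
    (S.degen e).out (some v) = some (S.out v) := if_neg h

theorem some_mem_degen_ins {v : S.Vert} {a : S.Edge} :
    (some a : Option S.Edge) ∈ (S.degen e).ins (some v) ↔ a ∈ S.ins v :=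
  (Option.some_injective _).mem_set_image

theorem degen_below_copy : (S.degen e).Below (some e) none :=
  Relation.ReflTransGen.single ⟨none, rfl, rfl⟩

theorem degen_below_some_some {a b : S.Edge} :
    (S.degen e).Below (some a) (some b) ↔ S.Below a b := by
  refine ⟨fun h => edgeMap_below (S.degenMap e) h, fun h => ?_⟩
  induction h with
  | refl => exact below_refl _
  | tail _ hs ih =>
    obtain ⟨v, hv, rfl⟩ := hs
    refine below_trans ?_ ih
    have hout : (S.degen e).Below ((S.degen e).out (some v)) (some _) :=
      out_below (some_mem_degen_ins.2 hv)
    by_cases h : S.out v = e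
    · rw [degen_out_some_of_eq h] at hout
      exact below_trans (h ▸ degen_below_copy) hout
    · rwa [degen_out_some_of_ne h] at hout

theorem degen_below_none_some {b : S.Edge} :
    (S.degen e).Below none (some b) ↔ S.Below e b ∧ b ≠ e := by
  constructor
  · intro h
    refine ⟨edgeMap_below (S.degenMap e) h, ?_⟩
    rintro rfl
    exact Option.some_ne_none _ (below_antisymm degen_below_copy h)
  · rintro ⟨h, hne⟩
    obtain heq | ⟨c, hc, v, hv, hve⟩ := Relation.ReflTransGen.cases_tail h
    · exact absurd heq.symm hne
    · have hout : (S.degen e).Below ((S.degen e).out (some v)) (some c) :=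
        out_below (some_mem_degen_ins.2 hv)
      rw [degen_out_some_of_eq hve] at hout
      exact below_trans hout (degen_below_some_some.2 hc)

theorem degen_below_some_none {a : S.Edge} : (S.degen e).Below (some a) none ↔ S.Below a e :=
  ⟨fun h => edgeMap_below (S.degenMap e) h,
    fun h => below_trans (degen_below_some_some.2 h) degen_below_copy⟩

theorem degen_below_none_iff {a : (S.degen e).Edge} :
    (S.degen e).Below a none ↔ a = none ∨ (S.degen e).Below a (some e) := by
  cases a with
  | none => exact iff_of_true (below_refl _) (Or.inl rfl)
  | some a =>
    rw [degen_below_some_none, degen_below_some_some]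
    exact (or_iff_right (Option.some_ne_none a)).symm

theorem degen_below_map_iff {f : R ⟶ S} (hf : Function.Injective (edgeMap f)) {a : R.Edge}
    {b c : (R.degen a).Edge} :
    (S.degen (edgeMap f a)).Below (b.map (edgeMap f)) (c.map (edgeMap f)) ↔
      (R.degen a).Below b c := by
  rcases b with _ | b <;> rcases c with _ | c
  · exact iff_of_true (below_refl _) (below_refl _)
  · refine degen_below_none_some.trans (Iff.trans ?_ degen_below_none_some.symm)
    rw [below_edgeMap_iff hf, hf.ne_iff]
  · refine degen_below_some_none.trans (Iff.trans ?_ degen_below_some_none.symm)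
    rw [below_edgeMap_iff hf]
  · refine degen_below_some_some.trans (Iff.trans ?_ degen_below_some_some.symm)
    rw [below_edgeMap_iff hf]

theorem degen_out_map {f : R ⟶ S} (hf : Function.Injective (edgeMap f)) {a : R.Edge}
    (u : (R.degen a).Vert) :
    (S.degen (edgeMap f a)).out (u.map (vertMap f hf)) = ((R.degen a).out u).map (edgeMap f) := by
  cases u with
  | none => rfl
  | some u =>
    have hu : S.out (vertMap f hf u) = edgeMap f a ↔ R.out u = a := by
      rw [out_vertMap, hf.eq_iff]
    change (S.degen _).out (some (vertMap f hf u)) = _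
    by_cases h : R.out u = a
    · rw [degen_out_some_of_eq h, degen_out_some_of_eq (hu.2 h)]
      rfl
    · rw [degen_out_some_of_ne h, degen_out_some_of_ne (hu.not.2 h), out_vertMap]
      rfl

section

variable (p : Planar (S.degen e))

theorem not_lt_of_none_mem {v : (S.degen e).Vert} (h : none ∈ (S.degen e).ins v)
    (i j : (S.degen e).ins v) : ¬ p.lt v i j := by
  obtain rfl : v = none := (S.degen e).ins_unique h rfl
  obtain rfl : i = j := Subtype.ext (i.2.trans j.2.symm)
  exact p.irrefl _ i

theorem left_none_iff {b : (S.degen e).Edge} : p.Left none b ↔ p.Left (some e) b := by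
  refine ⟨fun ⟨v, i, j, hij, hi, hj⟩ => ?_, fun h => h.mono degen_below_copy (below_refl _)⟩
  exact ⟨v, i, j, hij, (degen_below_none_iff.1 hi).resolve_left
    fun h => not_lt_of_none_mem p (h ▸ i.2) i j hij, hj⟩

theorem left_iff_none {b : (S.degen e).Edge} : p.Left b none ↔ p.Left b (some e) := by
  refine ⟨fun ⟨v, i, j, hij, hi, hj⟩ => ?_, fun h => h.mono (below_refl _) degen_below_copy⟩
  exact ⟨v, i, j, hij, hi, (degen_below_none_iff.1 hj).resolve_left
    fun h => not_lt_of_none_mem p (h ▸ j.2) i j hij⟩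

theorem left_iff_left_degenMap {a b : (S.degen e).Edge} :
    p.Left a b ↔ p.Left (some (edgeMap (S.degenMap e) a)) (some (edgeMap (S.degenMap e) b)) := by
  cases a <;> cases b
  · exact (left_none_iff p).trans (left_iff_none p)
  · exact left_none_iff p
  · exact left_iff_none p
  · exact Iff.rfl

theorem pullback_eq_of_comp_degenMap_eq {f g : R ⟶ S.degen e}
    (h : f ≫ S.degenMap e = g ≫ S.degenMap e) : Planar.pullback f p = Planar.pullback g p := by
  have hedge (a : R.Edge) :
      edgeMap (S.degenMap e) (edgeMap f a) = edgeMap (S.degenMap e) (edgeMap g a) := by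
    rw [← edgeMap_comp, h, edgeMap_comp]
  ext v i j
  change p.Left (edgeMap f i) (edgeMap f j) ↔ p.Left (edgeMap g i) (edgeMap g j)
  rw [left_iff_left_degenMap, hedge, hedge, ← left_iff_left_degenMap]

theorem before_some_iff {w : S.Vert} (hw : S.out w = e) (u : (S.degen e).Vert) :
    p.Before u (some w) ↔ u = none ∨ p.Before u none := by
  have hout : (S.degen e).out (some w) = none := degen_out_some_of_eq hw
  have hne : u ≠ some w ↔ (S.degen e).out u ≠ none := by
    rw [← hout]
    exact not_congr ⟨congrArg _, (S.degen e).out_inj⟩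
  have hbelow : ¬ (S.degen e).Below none (some e) := fun h => (degen_below_none_some.1 h).2 rfl
  change u ≠ some w ∧ _ ∨ _ ↔
    u = none ∨ u ≠ none ∧ (S.degen e).Below _ (some e) ∨ p.Left _ (some e)
  rw [hout, hne, left_iff_none, degen_below_none_iff]
  constructor
  · rintro (⟨hu, h⟩ | h)
    · exact (em (u = none)).imp_right fun hu' => Or.inl ⟨hu', h.resolve_left hu⟩
    · exact Or.inr (Or.inr h)
  · rintro (rfl | ⟨-, h⟩ | h)
    · exact Or.inl ⟨Option.some_ne_none e, Or.inr (below_refl _)⟩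
    · exact Or.inl ⟨fun hu => hbelow (hu ▸ h), Or.inr h⟩
    · exact Or.inr h

theorem label_some_eq_label_none_add_one {w : S.Vert} (hw : S.out w = e) :
    p.label (some w) = p.label none + 1 := by
  have h : {u | p.Before u (some w)} = insert none {u | p.Before u none} :=
    Set.ext fun u => before_some_iff p hw u
  exact (congrArg Set.ncard h).trans
    (Set.ncard_insert_of_notMem (fun h' => Planar.Before.irrefl (p := p) h') (Set.toFinite _))

end

/-! ### Faces of degenerate dendrices -/

theorem size_degen : (S.degen e).size = S.size + 1 := Finite.card_option

/-- The face of `σ_e S` which leaves out the copy of `e`. It is an inner face if there is a vertex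
above `e`, and a top face otherwise. -/
def IsUpperSection (f : (S.degen e).Face) : Prop :=
  (∃ w, S.out w = e ∧ f.vertex = some w ∧ f.kind = .inner) ∨ f.vertex = none ∧ f.kind = .top

/-- The face of `σ_e S` which leaves out `e` and keeps its copy. It is a bottom face if `e` is the
root, and an inner face otherwise. -/
def IsLowerSection (f : (S.degen e).Face) : Prop :=
  f.vertex = none ∧ (f.kind = .inner ∨ f.kind = .bottom none)

theorem exists_isUpperSection : ∃ f : (S.degen e).Face, IsUpperSection f := by
  by_cases h : ∃ w, S.out w = e
  · obtain ⟨w, hw⟩ := h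
    have hroot : (S.degen e).out (some w) ≠ (S.degen e).root :=
      (degen_out_some_of_eq hw).trans_ne (Option.some_ne_none _).symm
    obtain ⟨f, hv, hk⟩ := Face.exists_of_admits (T := S.degen e) (w := some w) (k := .inner) hroot
    exact ⟨f, Or.inl ⟨w, hw, hv, hk⟩⟩
  · have hleaf : (S.degen e).outline.IsLeaf none := by
      rintro (_ | w) - hw
      · exact Option.some_ne_none e hw
      · refine h ⟨w, by_contra fun hne => Option.some_ne_none (S.out w) ?_⟩
        exact (degen_out_some_of_ne hne).symm.trans hw
    obtain ⟨f, hv, hk⟩ := Face.exists_of_admits (T := S.degen e) (w := none) (k := .top)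
      (by rintro _ rfl; exact hleaf)
    exact ⟨f, Or.inr ⟨hv, hk⟩⟩

theorem exists_isLowerSection : ∃ f : (S.degen e).Face, IsLowerSection f := by
  by_cases h : e = S.root
  · obtain ⟨f, hv, hk⟩ := Face.exists_of_admits (T := S.degen e) (w := none) (k := .bottom none)
      ⟨congrArg some h, rfl, fun _ ha hne => absurd ha hne⟩
    exact ⟨f, hv, Or.inr hk⟩
  · obtain ⟨f, hv, hk⟩ := Face.exists_of_admits (T := S.degen e) (w := none) (k := .inner)
      (fun h' => h (Option.some.inj h'))
    exact ⟨f, hv, Or.inl hk⟩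

theorem IsUpperSection.range_incl {f : (S.degen e).Face} (hf : IsUpperSection f) :
    Set.range (edgeMap f.incl) = {none}ᶜ := by
  rw [f.range_incl, Set.compl_eq_univ_sdiff]
  change Set.univ \ _ = _
  rcases hf with ⟨w, hw, hv, hk⟩ | ⟨hv, hk⟩ <;> rw [hv, hk]
  · exact congrArg (fun a => Set.univ \ {a}) (degen_out_some_of_eq hw)
  · rfl

theorem IsLowerSection.range_incl {f : (S.degen e).Face} (hf : IsLowerSection f) :
    Set.range (edgeMap f.incl) = {some e}ᶜ := by
  rw [f.range_incl, Set.compl_eq_univ_sdiff]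
  change Set.univ \ _ = _
  obtain ⟨hv, hk | hk⟩ := hf <;> rw [hv, hk]
  · rfl
  · change Set.univ \ insert (some e) (({none} : Set (Option S.Edge)) \ {none}) = _
    rw [Set.sdiff_self]
    exact congrArg (Set.univ \ ·) (Set.singleton_def _).symm

theorem bijOn_degenMap {c : (S.degen e).Edge} (hc : edgeMap (S.degenMap e) c = e) :
    Set.BijOn (edgeMap (S.degenMap e)) {c}ᶜ Set.univ := by
  refine ⟨Set.mapsTo_univ _ _, ?_, fun a _ => ?_⟩
  · rcases c with _ | c
    · rintro (_ | a) ha (_ | b) hb hab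
      exacts [rfl, absurd rfl ha, absurd rfl hb, congrArg some hab]
    · obtain rfl : c = e := hc
      rintro (_ | a) ha (_ | b) hb hab
      exacts [rfl, absurd (congrArg some hab.symm) hb, absurd (congrArg some hab) ha,
        congrArg some hab]
  · by_cases ha : some a = c
    · subst ha
      exact ⟨none, (Option.some_ne_none a).symm, hc.symm⟩
    · exact ⟨some a, ha, rfl⟩

theorem exists_iso_of_range_incl {f : (S.degen e).Face} {c : (S.degen e).Edge}
    (hc : edgeMap (S.degenMap e) c = e) (hr : Set.range (edgeMap f.incl) = {c}ᶜ) :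
    ∃ α : f.tree ≅ S, α.hom = f.incl ≫ S.degenMap e := by
  refine exists_iso_hom_eq_of_bijective ?_ (f.size_tree size_degen)
  have hincl : Set.BijOn (edgeMap f.incl) Set.univ {c}ᶜ := by
    rw [← hr, ← Set.image_univ]
    exact f.incl_injective.injOn.bijOn_image
  exact Set.bijOn_univ.1 ((bijOn_degenMap hc).comp hincl)

theorem admits_degen_some {w : S.Vert} {k : FaceKind (S.degen e).Edge}
    (hk : (S.degen e).outline.Admits (some w) k) (hw : S.out w = e → k ≠ .inner) :
    ∃ k₀ : FaceKind S.Edge, k = k₀.map some ∧ S.outline.Admits w k₀ ∧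
      (S.degen e).outline.removedEdges (some w) k = some '' S.outline.removedEdges w k₀ ∧
      e ∉ S.outline.removedEdges w k₀ := by
  have hleaf (a : S.Edge) (ha : (S.degen e).outline.IsLeaf (some a)) :
      S.outline.IsLeaf a ∧ a ≠ e := by
    refine ⟨fun u _ hu => ?_, fun h => ha none trivial (congrArg some h.symm)⟩
    by_cases h : S.out u = e
    · exact ha none trivial (congrArg some (h.symm.trans hu))
    · exact ha (some u) trivial ((degen_out_some_of_ne h).trans (congrArg some hu))
  cases k with
  | inner =>
    have hne : S.out w ≠ e := fun h => hw h rfl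
    have hout := degen_out_some_of_ne hne
    exact ⟨.inner, rfl, fun h => hk (hout.trans (congrArg some h)),
      (congrArg _ hout).trans Set.image_singleton.symm, hne.symm⟩
  | top =>
    have hins (a : S.Edge) (ha : a ∈ S.ins w) := hleaf a (hk _ (some_mem_degen_ins.2 ha))
    exact ⟨.top, rfl, fun a ha => (hins a ha).1, rfl, fun h => (hins e h).2 rfl⟩
  | bottom a =>
    obtain ⟨hroot, ⟨a, ha, rfl⟩, hins⟩ := hk
    have hins (b : S.Edge) (hb : b ∈ S.ins w) (hba : b ≠ a) :=
      hleaf b (hins _ (some_mem_degen_ins.2 hb) fun h => hba (Option.some.inj h))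
    have hne : S.out w ≠ e := fun h =>
      Option.some_ne_none _ (hroot.symm.trans (degen_out_some_of_eq h))
    have hout := degen_out_some_of_ne hne
    refine ⟨.bottom a, rfl, ⟨Option.some.inj (hout.symm.trans hroot), ha,
      fun b hb hba => (hins b hb hba).1⟩, ?_, ?_⟩
    · change insert ((S.degen e).out (some w)) ((some '' S.ins w) \ {some a}) =
        some '' insert (S.out w) (S.ins w \ {a})
      rw [hout, Set.image_insert_eq, Set.image_sdiff (Option.some_injective _),
        Set.image_singleton]
      rfl
    · rintro (h | ⟨he, hea⟩)
      exacts [hne h.symm, (hins e he hea).2 rfl]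

theorem IsUpperSection.eq {f g : (S.degen e).Face} (hf : IsUpperSection f)
    (hg : IsUpperSection g) : f = g := by
  have hleaf {f : (S.degen e).Face} (hv : f.vertex = none) (hk : f.kind = .top) (w : S.Vert) :
      S.out w ≠ e := fun hw => by
    have h := f.admits
    rw [hv, hk] at h
    exact h none rfl (some w) trivial (degen_out_some_of_eq hw)
  rcases hf with ⟨w, hw, hfv, hfk⟩ | ⟨hfv, hfk⟩ <;> rcases hg with ⟨x, hx, hgv, hgk⟩ | ⟨hgv, hgk⟩
  · obtain rfl := S.out_inj (hw.trans hx.symm)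
    exact Face.ext_vertex_kind (hfv.trans hgv.symm) (hfk.trans hgk.symm)
  · exact absurd hw (hleaf hgv hgk w)
  · exact absurd hx (hleaf hfv hfk x)
  · exact Face.ext_vertex_kind (hfv.trans hgv.symm) (hfk.trans hgk.symm)

theorem IsLowerSection.eq {f g : (S.degen e).Face} (hf : IsLowerSection f)
    (hg : IsLowerSection g) : f = g := by
  have hroot {f g : (S.degen e).Face} (hf : f.vertex = none) (hfk : f.kind = .inner)
      (hg : g.vertex = none) (hgk : g.kind = .bottom none) : False := by
    have h := f.admits
    have h' := g.admits
    rw [hf, hfk] at h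
    rw [hg, hgk] at h'
    exact h h'.1
  obtain ⟨hfv, hfk | hfk⟩ := hf <;> obtain ⟨hgv, hgk | hgk⟩ := hg
  · exact Face.ext_vertex_kind (hfv.trans hgv.symm) (hfk.trans hgk.symm)
  · exact (hroot hfv hfk hgv hgk).elim
  · exact (hroot hgv hgk hfv hfk).elim
  · exact Face.ext_vertex_kind (hfv.trans hgv.symm) (hfk.trans hgk.symm)

theorem sgn_upperSection (p : Planar (S.degen e)) {f g : (S.degen e).Face}
    (hf : IsUpperSection f) (hg : IsLowerSection g) : f.sgn p = - g.sgn p := by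
  have hgsgn : g.sgn p = (-1) ^ p.label none := by
    obtain ⟨hv, hk | hk⟩ := hg <;> rw [Face.sgn_eq, hv, hk] <;> exact one_mul _
  rw [hgsgn, Face.sgn_eq]
  rcases hf with ⟨w, hw, hv, hk⟩ | ⟨hv, hk⟩ <;> rw [hv, hk]
  · rw [label_some_eq_label_none_add_one p hw, pow_succ, mul_neg_one]
    exact one_mul _
  · exact neg_one_mul _

theorem exists_face_of_not_section {f : (S.degen e).Face} (hu : ¬ IsUpperSection f)
    (hl : ¬ IsLowerSection f) : ∃ f₀ : S.Face, f.vertex = some f₀.vertex ∧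
      (S.degen e).outline.removedEdges f.vertex f.kind =
        some '' S.outline.removedEdges f₀.vertex f₀.kind ∧
      e ∉ S.outline.removedEdges f₀.vertex f₀.kind := by
  have hadm := f.admits
  cases hv : f.vertex with
  | none =>
    exfalso
    rw [hv] at hadm
    cases hk : f.kind with
    | inner => exact hl ⟨hv, Or.inl hk⟩
    | top => exact hu (Or.inr ⟨hv, hk⟩)
    | bottom a =>
      rw [hk] at hadm
      obtain ⟨-, rfl, -⟩ := hadm
      exact hl ⟨hv, Or.inr hk⟩
  | some w =>
    obtain ⟨k₀, -, hadm₀, hr, he⟩ :=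
      admits_degen_some (hv ▸ hadm) fun hw hk => hu (Or.inl ⟨w, hw, hv, hk⟩)
    obtain ⟨f₀, rfl, rfl⟩ := Face.exists_of_admits hadm₀
    exact ⟨f₀, rfl, hr, he⟩

theorem range_optionMap {A B : Type*} (φ : A → B) :
    Set.range (Option.map φ) = (some '' (Set.range φ)ᶜ)ᶜ := by
  ext b
  cases b <;> simp

theorem exists_iso_degen_face {f : (S.degen e).Face} (hu : ¬ IsUpperSection f)
    (hl : ¬ IsLowerSection f) : ∃ (f₀ : S.Face) (e₀ : f₀.tree.Edge) (α : f.tree ≅ f₀.tree.degen e₀),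
      f.incl ≫ S.degenMap e = (α.hom ≫ f₀.tree.degenMap e₀) ≫ f₀.incl := by
  obtain ⟨f₀, hv, hr, he⟩ := exists_face_of_not_section hu hl
  obtain ⟨e₀, rfl⟩ : e ∈ Set.range (edgeMap f₀.incl) := f₀.range_incl ▸ ⟨trivial, he⟩
  have hinj := f₀.incl_injective
  have hedges : Set.range (edgeMap f.incl) = Set.range (Option.map (edgeMap f₀.incl)) := by
    rw [range_optionMap, f.range_incl, f₀.range_incl]
    change Set.univ \ _ = (some '' (Set.univ \ _)ᶜ)ᶜ
    rw [hr, ← Set.compl_eq_univ_sdiff, ← Set.compl_eq_univ_sdiff, compl_compl]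
  have hverts : Set.range f.vert = Set.range (Option.map f₀.vert) := by
    rw [range_optionMap, f.range_vert, f₀.range_vert, hv, compl_compl]
    exact congrArg _ Set.image_singleton.symm
  have hout : Set.range (fun v => edgeMap f.incl (f.tree.out v)) =
      Set.range fun u => ((f₀.tree.degen e₀).out u).map (edgeMap f₀.incl) := by
    simp only [← degen_out_map hinj]
    rw [range_edgeMap_out f.incl f.incl_injective]
    exact (congrArg _ hverts).trans (Set.range_comp _ _).symm
  obtain ⟨α, hα⟩ := exists_iso_of_range_eq f.incl_injective (Option.map_injective hinj)
    (fun _ _ => below_edgeMap_iff f.incl_injective) (fun _ _ => degen_below_map_iff hinj)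
    hedges hout
  refine ⟨f₀, e₀, α, hom_ext fun a => ?_⟩
  rw [edgeMap_comp, edgeMap_comp, edgeMap_comp, ← hα]
  cases edgeMap α.hom a <;> rfl

end Degen

end Tree

theorem cls_mem_D {n : ℕ} {g : PlanarDendrex X n} (h : IsDegenerate g.dendrex) :
    g.cls ∈ D X n := AddSubgroup.subset_closure ⟨g, h, rfl⟩

theorem cls_face_upperSection_eq {n : ℕ} {S : Tree} {e : S.Edge}
    (hn : (S.degen e).size = n + 1) (p : Planar (S.degen e)) (y : X.obj (Opposite.op S))
    {f g : (S.degen e).Face} (hf : IsUpperSection f) (hg : IsLowerSection g) :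
    (PlanarDendrex.face ⟨S.degen e, hn, p, DendroidalSet.restrict (S.degenMap e) y⟩ f).cls =
      (PlanarDendrex.face ⟨S.degen e, hn, p, DendroidalSet.restrict (S.degenMap e) y⟩ g).cls := by
  obtain ⟨α, hα⟩ := exists_iso_of_range_incl rfl hf.range_incl
  obtain ⟨β, hβ⟩ := exists_iso_of_range_incl rfl hg.range_incl
  have hαβ : ((α ≪≫ β.symm).hom ≫ g.incl) ≫ S.degenMap e = f.incl ≫ S.degenMap e := by
    rw [Category.assoc, ← hβ, ← hα, Iso.trans_hom, Iso.symm_hom, Category.assoc, β.inv_hom_id,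
      Category.comp_id]
  refine Eq.symm ((cls_eq_of_iso _ (f.size_tree hn) _ (α ≪≫ β.symm) _).trans ?_)
  change PlanarDendrex.cls ⟨f.tree, _, _, _⟩ = PlanarDendrex.cls ⟨f.tree, _, _, _⟩
  rw [← Planar.pullback_comp, ← DendroidalSet.restrict_comp, ← DendroidalSet.restrict_comp,
    ← DendroidalSet.restrict_comp, hαβ, pullback_eq_of_comp_degenMap_eq p hαβ]

theorem faceSum_degen_mem_D {n : ℕ} {S : Tree} {e : S.Edge} (hn : (S.degen e).size = n + 1)
    (p : Planar (S.degen e)) (y : X.obj (Opposite.op S)) :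
    faceSum ⟨S.degen e, hn, p, DendroidalSet.restrict (S.degenMap e) y⟩ ∈ D X n := by
  classical
  obtain ⟨f, hf⟩ := exists_isUpperSection (S := S) (e := e)
  obtain ⟨g, hg⟩ := exists_isLowerSection (S := S) (e := e)
  have hgf : g ≠ f := by
    rintro rfl
    have h := compl_injective (hf.range_incl.symm.trans hg.range_incl)
    exact Option.some_ne_none e (Set.singleton_injective h).symm
  rw [faceSum, ← Finset.add_sum_erase _ _ (Finset.mem_univ f),
    ← Finset.add_sum_erase _ _ (Finset.mem_erase.2 ⟨hgf, Finset.mem_univ g⟩), ← add_assoc]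
  refine add_mem ?_ (sum_mem fun f' hf' => AddSubgroup.zsmul_mem _ (cls_mem_D ?_) _)
  · rw [cls_face_upperSection_eq hn p y hf hg, ← add_smul]
    change (f.sgn p + g.sgn p) • _ ∈ _
    rw [sgn_upperSection p hf hg, neg_add_cancel, zero_smul]
    exact zero_mem _
  · rw [Finset.mem_erase, Finset.mem_erase] at hf'
    obtain ⟨f₀, e₀, α, hα⟩ := exists_iso_degen_face (f := f') (fun h => hf'.2.1 (h.eq hf))
      (fun h => hf'.1 (h.eq hg))
    refine ⟨f₀.tree, e₀, α, DendroidalSet.restrict f₀.incl y, ?_⟩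
    change DendroidalSet.restrict f'.incl (DendroidalSet.restrict (S.degenMap e) y) = _
    rw [← DendroidalSet.restrict_comp, ← DendroidalSet.restrict_comp, hα]
    rfl

theorem faceSum_mem_D {n : ℕ} {g : PlanarDendrex X (n + 1)} (h : IsDegenerate g.dendrex) :
    faceSum g ∈ D X n := by
  obtain ⟨T, hT, p, x⟩ := g
  obtain ⟨S, e, (α : T ≅ S.degen e), y,
    (rfl : x = DendroidalSet.restrict (α.hom ≫ S.degenMap e) y)⟩ := h
  have hn : (S.degen e).size = n + 1 := (size_eq_of_iso α).symm.trans hT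
  rw [faceSum_eq_of_iso hT hn p α.symm, Iso.symm_hom, ← DendroidalSet.restrict_comp,
    α.inv_hom_id_assoc]
  exact faceSum_degen_mem_D hn _ y

theorem IsFaceDifferential.map_mem_D {d : ∀ n : ℕ, Chun X (n + 1) →+ Chun X n}
    (hd : IsFaceDifferential X d) (n : ℕ) : ∀ y ∈ D X (n + 1), d n y ∈ D X n := by
  suffices h : D X (n + 1) ≤ (D X n).comap (d n) from h
  rw [D, AddSubgroup.closure_le]
  rintro _ ⟨g, hg, rfl⟩
  rw [SetLike.mem_coe, AddSubgroup.mem_comap, hd]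
  exact faceSum_mem_D hg

end Dendroidal

theorem proposition4p3 (X : Dendroidal.DendroidalSet.{u}) :
    (∃! d : ∀ n : ℕ, Dendroidal.Chun X (n + 1) →+ Dendroidal.Chun X n,
      Dendroidal.IsFaceDifferential X d) ∧
    ∀ d : ∀ n : ℕ, Dendroidal.Chun X (n + 1) →+ Dendroidal.Chun X n,
      Dendroidal.IsFaceDifferential X d →
        (∀ n : ℕ, (d n).comp (d (n + 1)) = 0) ∧
        ∀ n : ℕ, ∀ y ∈ Dendroidal.D X (n + 1), d n y ∈ Dendroidal.D X n := by
  refine ⟨⟨Dendroidal.differential X, Dendroidal.isFaceDifferential_differential X,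
    fun d hd => funext fun n => Dendroidal.chun_hom_ext fun g => ?_⟩,
    fun d hd => ⟨hd.comp_eq_zero, hd.map_mem_D⟩⟩
  rw [hd, Dendroidal.isFaceDifferential_differential X]
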